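/- **Setting.** Let $X_k=\{X_k(n):n\ge 1\}$, $k\in[K]=\{1,\dots,K\}$, be independent data streams. Stream $k$ has law $\mathrm P_k^1$ if it is a signal and $\mathrm P_k^0$ if it is noise. For $A\subseteq[K]$ let $\mathrm P_A$ (with expectation $\mathrm E_A$) be the product law of $(X_1,\dots,X_K)$ when $A$ is the set of signals. Let $\mathcal F_k(n)=\sigma(X_k(1),\dots,X_k(n))$ and $\mathcal F(n)=\sigma(\mathcal F_1(n),\dots,\mathcal F_K(n))$. Assume that $\mathrm P_k^1$ and $\mathrm P_k^0$ are mutually absolutely continuous on each $\mathcal F_k(n)$, $n\ge1$, and let $\lambda_k(n)=\log\frac{d\mathrm P_k^1}{d\mathrm P_k^0}(\mathcal F_k(n))$. Assume that there are numbers $I_k,J_k>0$ such that, for every $k\in[K]$, $$\mathrm P_k^1\Big(\limsup_{n}\tfrac{\lambda_k(n)}n\le I_k\Big)=1,\qquad \mathrm P_k^0\Big(\limsup_{n}\tfrac{-\lambda_k(n)}n\le J_k\Big)=1,$$ and, for every $\epsilon>0$, $$\sum_{n\ge1}\mathrm P_k^1\Big(\tfrac{\lambda_k(n)}n\le I_k-\epsilon\Big)<\infty,\qquad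 \sum_{n\ge1}\mathrm P_k^0\Big(\tfrac{-\lambda_k(n)}n\le J_k-\epsilon\Big)<\infty .$$ **Procedures.** Let $0\le l\le u\le K$ with $u>0$, $l<K$, and let $\Pi_{l,u}=\{A\subseteq[K]:l\le|A|\le u\}$. A sequential multiple testing procedure consists of random times $T_k\in\{1,2,\dots\}\cup\{\infty\}$ and a random set $\mathbf D\subseteq[K]$ of streams identified as signals, such that, for all $k\in[K]$ and $n\ge1$, the events $\{T_k=n\}$, $\{T_k=n,\,k\in\mathbf D\}$ and $\{T_k=n,\,k\notin\mathbf D\}$ belong to $\mathcal F(n)$. It is synchronous if $T_1=\dots=T_K$. For $\alpha,\beta\in(0,1)$, $\Delta(\alpha,\beta,\Pi_{l,u})$ is the set of the procedures with $\mathrm P_A(T_k<\infty)=1$ for all $k\in[K]$, $\mathrm P_A(\mathbf D\setminus A\ne\emptyset)\le\alpha$ and $\mathrm P_A(A\setminus\mathbf D\neq\emptyset)\le\beta$ for every $A\in\Pi_{l,u}$. For $A\in\Pi_{l,u}$, let $\mathcal L''_A(\alpha,\beta,\Pi_{l,u})$ be the infimum of $\mathrm E_A[T_1]$ over all synchronous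 procedures in $\Delta(\alpha,\beta,\Pi_{l,u})$. **The procedure $\check\chi=(\check T,\check{\mathbf D})$.** Let $\lambda_{(1)}(n)\ge\dots\ge\lambda_{(K)}(n)$ be the ordered values of $\lambda_1(n),\dots,\lambda_K(n)$, put $\lambda_{(0)}(n)=+\infty$ and $\lambda_{(K+1)}(n)=-\infty$, and let $p(n)=|\{k:\lambda_k(n)>0\}|$. Let $a,b,c,d>0$ be thresholds; infima are over $n\ge1$, and $\inf\emptyset=\infty$. If $l=u$, then $$\check T=\inf\{n:\lambda_{(l)}(n)-\lambda_{(l+1)}(n)\ge\max(c,d)\}.$$ If $l<u$, then $\check T=\min\{\tau_1,\tau_2,\tau_3\}$, where $$\begin{aligned}\tau_1&=\inf\{n:\lambda_{(l+1)}(n)\le\min\{-b,\,-c+\lambda_{(l)}(n)\}\},\\ \tau_2&=\inf\{n:\lambda_k(n)\notin(-b,a)\ \text{for all } k\in[K],\ \text{and } l\le p(n)\le u\},\\ \tau_3&=\inf\{n:\lambda_{(u)}(n)\ge\max\{a,\,d+\lambda_{(u+1)}(n)\}\}.\end{aligned}$$ In both cases $\check{\mathbf D}$ is the set of the $\min\{\max\{p(\check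 T),l\},u\}$ streams with the largest $\lambda_k(\check T)$. **Theorem 4.3.** Suppose that the thresholds $a,b,c,d>0$ are functions of $(\alpha,\beta)$ such that $\check\chi\in\Delta(\alpha,\beta,\Pi_{l,u})$ for all $\alpha,\beta\in(0,1)$ and such that $a,c\sim|\log\alpha|$ and $b,d\sim|\log\beta|$ as $\alpha,\beta\to0$. Put $\mathcal I_A=\min_{i\in A}I_i$ and $\mathcal J_A=\min_{j\notin A}J_j$, where $\min\emptyset=\infty$, $x/\infty=0$ for real $x$, and $\infty\cdot 0=0$. Then, for every $A\in\Pi_{l,u}$, as $\alpha,\beta\to0$ (jointly, in any manner), $$\mathrm E_A[\check T]\;\sim\;\mathcal L''_A(\alpha,\beta,\Pi_{l,u})\;\sim\;\max\left\{\frac{|\log\alpha|}{\mathcal I_A+\mathcal J_A\,\mathbf 1\{|A|=l\}},\ \frac{|\log\beta|}{\mathcal J_A+\mathcal I_A\,\mathbf 1\{|A|=u\}}\right\},$$ where $f\sim g$ means that $f/g\to1$. -/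

import Mathlib

open MeasureTheory Filter
open scoped Topology ENNReal

namespace SeqMT

/-! Data streams are modelled on the canonical space.  The sequence of observations of stream `k`
is a point `x : ℕ → E k`, with `x t` the observation collected at time `t + 1`, so that the first
`n` observations are the coordinates `t < n`. -/

section Stream

variable {E : Type*} [MeasurableSpace E]

/-- The σ-algebra generated by the first `n` observations of a single stream. -/
abbrev streamSigma (E : Type*) [MeasurableSpace E] (n : ℕ) : MeasurableSpace (ℕ → E) :=
  ⨆ t ∈ Finset.range n, MeasurableSpace.comap (fun x : ℕ → E => x t) inferInstance

theorem streamSigma_le (n : ℕ) : streamSigma E n ≤ MeasurableSpace.pi :=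
  iSup₂_le fun t _ => (measurable_pi_apply t).comap_le

theorem streamSigma_mono {m n : ℕ} (h : m ≤ n) : streamSigma E m ≤ streamSigma E n :=
  iSup₂_le fun t ht =>
    le_iSup₂_of_le t (Finset.mem_range.2 (lt_of_lt_of_le (Finset.mem_range.1 ht) h)) le_rfl

/-- The restriction of a law `μ` of a stream to the σ-algebra of its first `n` observations. -/
noncomputable def restrictLaw (μ : Measure (ℕ → E)) (n : ℕ) :
    @Measure (ℕ → E) (streamSigma E n) :=
  μ.trim (streamSigma_le n)

/-- The two laws are mutually absolutely continuous on the first `n` observations, for all `n`. -/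
def LocallyEquivalent (μ₁ μ₀ : Measure (ℕ → E)) : Prop :=
  ∀ n : ℕ, 1 ≤ n →
    (restrictLaw μ₁ n).AbsolutelyContinuous (restrictLaw μ₀ n) ∧
      (restrictLaw μ₀ n).AbsolutelyContinuous (restrictLaw μ₁ n)

/-- The log-likelihood ratio `log (dμ₁/dμ₀)` of the first `n` observations. -/
noncomputable def streamLLR (μ₁ μ₀ : Measure (ℕ → E)) (n : ℕ) : (ℕ → E) → ℝ :=
  @llr _ (streamSigma E n) (restrictLaw μ₁ n) (restrictLaw μ₀ n)

/-- `limsup ξ(n)/n ≤ r` almost surely under `μ`; the limsup is taken in the extended reals. -/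
def LimsupRateLE (μ : Measure (ℕ → E)) (ξ : ℕ → (ℕ → E) → ℝ) (r : ℝ) : Prop :=
  ∀ᵐ x ∂μ, limsup (fun n : ℕ => ((ξ n x / n : ℝ) : EReal)) atTop ≤ (r : EReal)

/-- `∑_{n ≥ 1} μ(ξ(n)/n ≤ r - ε) < ∞` for every `ε > 0`. -/
def CompleteLowerRate (μ : Measure (ℕ → E)) (ξ : ℕ → (ℕ → E) → ℝ) (r : ℝ) : Prop :=
  ∀ ε : ℝ, 0 < ε →
    ∑' n : ℕ, μ {x | ξ (n + 1) x / ((n + 1 : ℕ) : ℝ) ≤ r - ε} < ⊤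

end Stream

section Procedures

variable {K : ℕ} {E : Fin K → Type*} [∀ k, MeasurableSpace (E k)]

/-- The observations of all the streams. -/
abbrev Obs (E : Fin K → Type*) : Type _ := ∀ k, ℕ → E k

/-- The filtration generated by the observations of all the streams. -/
def obsFiltration (E : Fin K → Type*) [∀ k, MeasurableSpace (E k)] :
    Filtration ℕ (MeasurableSpace.pi : MeasurableSpace (Obs E)) where
  seq n := ⨆ k, MeasurableSpace.comap (fun ω : Obs E => ω k) (streamSigma (E k) n)
  mono' _ _ h := iSup_mono fun _ => MeasurableSpace.comap_mono (streamSigma_mono h)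
  le' n := iSup_le fun k =>
    (MeasurableSpace.comap_mono (streamSigma_le n)).trans (measurable_pi_apply k).comap_le

/-- The joint law when `A` is the set of signals: the streams are independent, stream `k` has
law `P₁ k` if `k ∈ A` and `P₀ k` otherwise. -/
noncomputable def jointLaw (P₀ P₁ : ∀ k, Measure (ℕ → E k)) (A : Finset (Fin K)) :
    Measure (Obs E) :=
  Measure.pi fun k => if k ∈ A then P₁ k else P₀ k

/-- The class of all sets of signals whose size is between `l` and `u`. -/
def signalClass (K l u : ℕ) : Set (Finset (Fin K)) :=
  {A | l ≤ A.card ∧ A.card ≤ u}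

/-- Decision times `T k` (with value `⊤` if no decision is made in stream `k`) together with the
set `D` of streams that are identified as signals. -/
structure DecisionRule (E : Fin K → Type*) where
  T : Fin K → Obs E → ℕ∞
  D : Obs E → Finset (Fin K)

/-- Sequential multiple testing procedures: each `T k ≥ 1` is a stopping time, and
`{T k = n, D k = i}` belongs to the σ-algebra of the observations up to time `n`. -/
def DecisionRule.IsSequentialTest (χ : DecisionRule E) : Prop :=
  ∀ k, IsStoppingTime (obsFiltration E) (χ.T k) ∧ (∀ ω, 1 ≤ χ.T k ω) ∧
    ∀ n : ℕ, 1 ≤ n →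
      MeasurableSet[obsFiltration E n] {ω | χ.T k ω = n ∧ k ∈ χ.D ω} ∧
      MeasurableSet[obsFiltration E n] {ω | χ.T k ω = n ∧ k ∉ χ.D ω}

/-- All decisions are made at the same time. -/
def DecisionRule.IsSynchronous (χ : DecisionRule E) : Prop :=
  ∀ j k, χ.T j = χ.T k

/-- Type-I familywise error rate: the probability that some noise is identified as a signal. -/
noncomputable def DecisionRule.fwe1 (χ : DecisionRule E) (P₀ P₁ : ∀ k, Measure (ℕ → E k))
    (A : Finset (Fin K)) : ℝ≥0∞ :=
  jointLaw P₀ P₁ A {ω | ∃ j, j ∉ A ∧ j ∈ χ.D ω}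

/-- Type-II familywise error rate: the probability that some signal is identified as noise. -/
noncomputable def DecisionRule.fwe2 (χ : DecisionRule E) (P₀ P₁ : ∀ k, Measure (ℕ → E k))
    (A : Finset (Fin K)) : ℝ≥0∞ :=
  jointLaw P₀ P₁ A {ω | ∃ i, i ∈ A ∧ i ∉ χ.D ω}

/-- Procedures that, for every set of signals in the class `C`, terminate almost surely in every
stream and have familywise error rates of type I and II at most `α` and `β`. -/
def ControlledTests (P₀ P₁ : ∀ k, Measure (ℕ → E k)) (α β : ℝ) (C : Set (Finset (Fin K))) :
    Set (DecisionRule E) :=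
  {χ | χ.IsSequentialTest ∧ ∀ A ∈ C,
    (∀ k, ∀ᵐ ω ∂(jointLaw P₀ P₁ A), χ.T k ω < ⊤) ∧
    χ.fwe1 P₀ P₁ A ≤ ENNReal.ofReal α ∧ χ.fwe2 P₀ P₁ A ≤ ENNReal.ofReal β}

/-- The expected decision time in stream `k` when the set of signals is `A`. -/
noncomputable def DecisionRule.expectedTime (χ : DecisionRule E)
    (P₀ P₁ : ∀ k, Measure (ℕ → E k)) (A : Finset (Fin K)) (k : Fin K) : ℝ≥0∞ :=
  ∫⁻ ω, (χ.T k ω : ℝ≥0∞) ∂(jointLaw P₀ P₁ A)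

/-- The optimal expected decision time among the synchronous procedures in
`ControlledTests P₀ P₁ α β C` when the set of signals is `A`.  The decision time is read off in
stream `k`; for synchronous procedures it is the same in all streams. -/
noncomputable def optimalSyncTime (P₀ P₁ : ∀ k, Measure (ℕ → E k)) (α β : ℝ)
    (C : Set (Finset (Fin K))) (A : Finset (Fin K)) (k : Fin K) : ℝ≥0∞ :=
  ⨅ χ ∈ {χ : DecisionRule E | χ.IsSynchronous} ∩ ControlledTests P₀ P₁ α β C,
    χ.expectedTime P₀ P₁ A k

/-- The log-likelihood ratio of stream `k` at time `n`, as a function of all the observations. -/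
noncomputable def obsLLR (P₀ P₁ : ∀ k, Measure (ℕ → E k)) (n : ℕ) (ω : Obs E) (k : Fin K) : ℝ :=
  streamLLR (P₁ k) (P₀ k) n (ω k)

end Procedures

section Synchronous

variable {K : ℕ}

/-- The `r`-th largest of the numbers `x k`, for `1 ≤ r ≤ K`: the largest level `t` that is
reached by at least `r` of them.  It is `+∞` for `r = 0` and `-∞` for `r > K`. -/
noncomputable def orderStat (x : Fin K → ℝ) (r : ℕ) : EReal :=
  sSup {t : EReal | r ≤ (Finset.univ.filter fun k => t ≤ (x k : EReal)).card}

/-- The number of positive coordinates. -/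
noncomputable def numPos (x : Fin K → ℝ) : ℕ :=
  (Finset.univ.filter fun k => 0 < x k).card

/-- The `s` streams with the largest values; ties are broken in favour of the smaller index. -/
noncomputable def topStreams (x : Fin K → ℝ) (s : ℕ) : Finset (Fin K) :=
  Finset.univ.filter fun k =>
    (Finset.univ.filter fun j => x k < x j ∨ (x j = x k ∧ j < k)).card < s

/-- The first time `n ≥ 1` at which `p` holds, and `⊤` if there is none. -/
noncomputable def firstTime (p : ℕ → Prop) : ℕ∞ :=
  ⨅ n ∈ {n : ℕ | 1 ≤ n ∧ p n}, (n : ℕ∞)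

/-- The stopping time of the gap rule (`l = u`) and of the gap-intersection rule (`l ≠ u`) along
a trajectory `x` of the vector of log-likelihood ratios. -/
noncomputable def syncTime (l u : ℕ) (a b c d : ℝ) (x : ℕ → Fin K → ℝ) : ℕ∞ :=
  if l = u then
    firstTime fun n => ((max c d : ℝ) : EReal) ≤ orderStat (x n) l - orderStat (x n) (l + 1)
  else
    min (firstTime fun n =>
        orderStat (x n) (l + 1) ≤ min (-b : EReal) (-c + orderStat (x n) l))
      (min
        (firstTime fun n =>
          (∀ k, x n k ∉ Set.Ioo (-b) a) ∧ l ≤ numPos (x n) ∧ numPos (x n) ≤ u)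
        (firstTime fun n =>
          max (a : EReal) (d + orderStat (x n) (u + 1)) ≤ orderStat (x n) u))

/-- The streams identified as signals at the stopping time: those with the `(p ∨ l) ∧ u` largest
log-likelihood ratios, where `p` is the number of positive ones (so there are `l` of them if
`l = u`).  The value is immaterial if the stopping time is infinite. -/
noncomputable def syncDecision (l u : ℕ) (a b c d : ℝ) (x : ℕ → Fin K → ℝ) : Finset (Fin K) :=
  if syncTime l u a b c d x = ⊤ then ∅
  else
    let y := x (syncTime l u a b c d x).toNat
    topStreams y (min (max (numPos y) l) u)

/-- The synchronous procedure with thresholds `a, b, c, d`: the gap rule if `l = u`, and the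
gap-intersection rule if `l < u`. -/
noncomputable def syncTest {E : Fin K → Type*} [∀ k, MeasurableSpace (E k)]
    (P₀ P₁ : ∀ k, Measure (ℕ → E k)) (l u : ℕ) (a b c d : ℝ) : DecisionRule E where
  T _ ω := syncTime l u a b c d fun n => obsLLR P₀ P₁ n ω
  D ω := syncDecision l u a b c d fun n => obsLLR P₀ P₁ n ω

/-- The minimum of the numbers `r k` over `k ∈ S`, which is `∞` if `S` is empty. -/
noncomputable def minOver (r : Fin K → ℝ) (S : Finset (Fin K)) : ℝ≥0∞ :=
  ⨅ k ∈ S, ENNReal.ofReal (r k)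

/-- The first-order approximation
`max {|log α| / (I_A + J_A 1{|A| = l}), |log β| / (J_A + I_A 1{|A| = u})}`, where `I_A` is the
minimum of `I` over `A` and `J_A` is the minimum of `J` over the complement of `A`. -/
noncomputable def syncRate (I J : Fin K → ℝ) (l u : ℕ) (A : Finset (Fin K)) (α β : ℝ) : ℝ≥0∞ :=
  max
    (ENNReal.ofReal |Real.log α| / (minOver I A + if A.card = l then minOver J Aᶜ else 0))
    (ENNReal.ofReal |Real.log β| / (minOver J Aᶜ + if A.card = u then minOver I A else 0))

end Synchronous

/-- `f ∼ g` as `α, β ↓ 0`: the ratio tends to `1`. -/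
def AsympEquiv (f g : ℝ → ℝ → ℝ≥0∞) : Prop :=
  Tendsto (fun p : ℝ × ℝ => f p.1 p.2 / g p.1 p.2) (𝓝[>] 0 ×ˢ 𝓝[>] 0) (𝓝 1)

/-- A threshold `h(α, β)` satisfies `h ∼ |log γ|` as `α, β ↓ 0`, where `γ = γ(α, β)`. -/
def ThresholdEquiv (h : ℝ → ℝ → ℝ) (γ : ℝ × ℝ → ℝ) : Prop :=
  Tendsto (fun p : ℝ × ℝ => h p.1 p.2 / |Real.log (γ p)|) (𝓝[>] 0 ×ˢ 𝓝[>] 0) (𝓝 1)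

end SeqMT

open SeqMT

/-! Let `s` be the maximum of |log α| and |log β|, weighted by the reciprocals of the two
denominators of the rate. The expected time of the rule and the optimum are both squeezed between (1
- δ) s and (1 + δ) s. The rule belongs to the controlled class by hypothesis, so the optimum lies
below its expected time. It remains to bound the optimum from below and the rule from above.

Lower bound: a change of measure. Given a signal i of A, choose an alternative A' in the class for
which i is noise: delete i if |A| > l, and otherwise exchange i for some noise j, because the
deletion would leave the class. The event that i is declared a signal has probability at least 1 - β
under A and at most α under A'. A test can achieve this only once the log-likelihood ratio of A
against A' is about |log α|. That ratio grows at rate at most I_i, respectively I_i + J_j, so about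
|log α| divided by this rate observations are needed; taking i and j to be minimisers gives the
stated term. Noises of A give the other term in the same way, with α and β exchanged. Each bound
uses the other error level only through its tending to 0, so α and β may vanish in any manner. The
core is `eventually_le_lintegral_time`.

Upper bound: at a time n when every log-likelihood ratio has grown at rate at least 1 - ε times its
nominal one, signals and noises are separated, and the rule stops by n as soon as n exceeds the
thresholds times the weights, up to 1 / (1 - ε) (`syncTime_le_of_growth`). The expected number of
exceptional times is finite by the summability hypothesis and does not depend on the thresholds, so
it is a bounded error (`exists_expectedTime_le`). -/

namespace SeqMT

/-! ### Densities of product laws -/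

open ProbabilityTheory in
theorem lintegral_pi_prod {ι : Type*} [Fintype ι] {X : ι → Type*} [∀ i, MeasurableSpace (X i)]
    (μ : ∀ i, Measure (X i)) [∀ i, IsProbabilityMeasure (μ i)] (f : ∀ i, X i → ℝ≥0∞)
    (hf : ∀ i, Measurable (f i)) :
    ∫⁻ x, ∏ i, f i (x i) ∂(Measure.pi μ) = ∏ i, ∫⁻ x, f i x ∂(μ i) := by
  have hind : iIndepFun (fun i (x : ∀ i, X i) => f i (x i)) (Measure.pi μ) :=
    iIndepFun_pi fun i => (hf i).aemeasurable
  have h := lintegral_prod_eq_prod_lintegral_of_indepFun Finset.univ _ hind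
    fun i => (hf i).comp (measurable_pi_apply i)
  rw [h]
  refine Finset.prod_congr rfl fun i _ => ?_
  exact (measurePreserving_eval μ i).lintegral_comp (hf i)

/-- A product of laws with densities on sub-σ-algebras has the product density on the product of
the sub-σ-algebras. -/
theorem pi_apply_eq_setLIntegral {ι : Type*} [Fintype ι] {X : ι → Type*}
    (m : ∀ i, MeasurableSpace (X i)) [m0 : ∀ i, MeasurableSpace (X i)] (hm : ∀ i, m i ≤ m0 i)
    (μ ν : ∀ i, Measure (X i)) [∀ i, IsProbabilityMeasure (μ i)]
    [∀ i, IsProbabilityMeasure (ν i)] (f : ∀ i, X i → ℝ≥0∞)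
    (hf : ∀ i, Measurable (f i))
    (h : ∀ i (B : Set (X i)), MeasurableSet[m i] B → ν i B = ∫⁻ x in B, f i x ∂(μ i))
    {G : Set (∀ i, X i)} (hG : MeasurableSet[@MeasurableSpace.pi _ _ m] G) :
    Measure.pi ν G = ∫⁻ x in G, ∏ i, f i (x i) ∂(Measure.pi μ) := by
  have hle : @MeasurableSpace.pi _ _ m ≤ MeasurableSpace.pi :=
    iSup_mono fun i => MeasurableSpace.comap_mono (hm i)
  rw [← withDensity_apply _ (hle _ hG)]
  have hbox : ∀ B : ∀ i, Set (X i), (∀ i, MeasurableSet[m i] (B i)) →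
      Measure.pi ν (Set.univ.pi B) =
        (Measure.pi μ).withDensity (fun x => ∏ i, f i (x i)) (Set.univ.pi B) := by
    intro B hB
    have hB' : MeasurableSet (Set.univ.pi B) :=
      MeasurableSet.univ_pi fun i => hm i _ (hB i)
    rw [Measure.pi_pi, withDensity_apply _ hB', ← lintegral_indicator hB']
    -- The indicator of a box factors over the coordinates, so the integral over the box does too.
    have : (Set.univ.pi B).indicator (fun x => ∏ i, f i (x i)) =
        fun x => ∏ i, (B i).indicator (f i) (x i) := by
      funext x
      by_cases hx : x ∈ Set.univ.pi B
      · rw [Set.indicator_of_mem hx]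
        exact Finset.prod_congr rfl fun i _ => (Set.indicator_of_mem (hx i trivial) _).symm
      · rw [Set.indicator_of_notMem hx]
        simp only [Set.mem_univ_pi, not_forall] at hx
        obtain ⟨i, hi⟩ := hx
        exact (Finset.prod_eq_zero (Finset.mem_univ i) (Set.indicator_of_notMem hi _)).symm
    rw [this, lintegral_pi_prod μ _ fun i => (hf i).indicator (hm i _ (hB i))]
    refine Finset.prod_congr rfl fun i _ => ?_
    rw [lintegral_indicator (hm i _ (hB i)), h i _ (hB i)]
  refine ext_on_measurableSpace_of_generate_finite (μ := Measure.pi ν)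
    (ν := (Measure.pi μ).withDensity fun x => ∏ i, f i (x i)) _
    (Set.univ.pi '' Set.univ.pi fun i => {s : Set (X i) | MeasurableSet[m i] s}) ?_ hle
    (@generateFrom_pi _ _ _ m).symm (@isPiSystem_pi _ _ m) ?_ hG
  · rintro _ ⟨B, hB, rfl⟩
    exact hbox B fun i => hB i trivial
  · have := hbox (fun _ => Set.univ) fun i => @MeasurableSet.univ _ (m i)
    rwa [Set.pi_univ] at this

/-! ### Likelihood ratios of one stream -/

section Stream

variable {E : Type*} [MeasurableSpace E]

theorem measurable_streamLLR (μ₁ μ₀ : Measure (ℕ → E)) (n : ℕ) :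
    Measurable[streamSigma E n] (streamLLR μ₁ μ₀ n) :=
  @measurable_llr _ (streamSigma E n) (restrictLaw μ₁ n) (restrictLaw μ₀ n)

theorem exp_streamLLR_setLIntegral (μ₁ μ₀ : Measure (ℕ → E)) [IsProbabilityMeasure μ₁]
    [IsProbabilityMeasure μ₀] (h : LocallyEquivalent μ₁ μ₀) {n : ℕ} (hn : 1 ≤ n)
    {B : Set (ℕ → E)} (hB : MeasurableSet[streamSigma E n] B) :
    μ₁ B = ∫⁻ x in B, ENNReal.ofReal (Real.exp (streamLLR μ₁ μ₀ n x)) ∂μ₀ := by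
  obtain ⟨h10, h01⟩ := h n hn
  have : IsProbabilityMeasure (restrictLaw μ₁ n) := ⟨by
    rw [restrictLaw, trim_measurableSet_eq _ MeasurableSet.univ, measure_univ]⟩
  have : IsProbabilityMeasure (restrictLaw μ₀ n) := ⟨by
    rw [restrictLaw, trim_measurableSet_eq _ MeasurableSet.univ, measure_univ]⟩
  rw [← setLIntegral_trim (streamSigma_le n)
    (measurable_streamLLR μ₁ μ₀ n).exp.ennreal_ofReal hB,
    ← trim_measurableSet_eq (streamSigma_le n) hB]
  change restrictLaw μ₁ n B = ∫⁻ x in B, _ ∂(restrictLaw μ₀ n)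
  rw [← @Measure.setLIntegral_rnDeriv _ (streamSigma E n) _ _ _ _ h10]
  refine lintegral_congr_ae (ae_restrict_of_ae ?_)
  -- Absolute continuity in the reverse direction makes the density positive almost everywhere.
  -- Where it vanishes, `Real.log 0 = 0` would give 1 instead of the density.
  filter_upwards [exp_llr_of_ac' _ _ h01, Measure.rnDeriv_lt_top (restrictLaw μ₁ n)
    (restrictLaw μ₀ n)] with x hx hx'
  rw [streamLLR, hx, ENNReal.ofReal_toReal hx'.ne]

theorem exp_neg_streamLLR_setLIntegral (μ₁ μ₀ : Measure (ℕ → E)) [IsProbabilityMeasure μ₁]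
    [IsProbabilityMeasure μ₀] (h : LocallyEquivalent μ₁ μ₀) {n : ℕ} (hn : 1 ≤ n)
    {B : Set (ℕ → E)} (hB : MeasurableSet[streamSigma E n] B) :
    μ₀ B = ∫⁻ x in B, ENNReal.ofReal (Real.exp (-streamLLR μ₁ μ₀ n x)) ∂μ₁ := by
  obtain ⟨h10, h01⟩ := h n hn
  have : IsProbabilityMeasure (restrictLaw μ₁ n) := ⟨by
    rw [restrictLaw, trim_measurableSet_eq _ MeasurableSet.univ, measure_univ]⟩
  have : IsProbabilityMeasure (restrictLaw μ₀ n) := ⟨by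
    rw [restrictLaw, trim_measurableSet_eq _ MeasurableSet.univ, measure_univ]⟩
  have hmeas : Measurable[streamSigma E n]
      fun x => ENNReal.ofReal (Real.exp (-streamLLR μ₁ μ₀ n x)) :=
    (measurable_streamLLR μ₁ μ₀ n).neg.exp.ennreal_ofReal
  rw [← setLIntegral_trim (streamSigma_le n) hmeas hB, ← trim_measurableSet_eq (streamSigma_le n) hB]
  change restrictLaw μ₀ n B = ∫⁻ x in B, _ ∂(restrictLaw μ₁ n)
  rw [← @Measure.setLIntegral_rnDeriv _ (streamSigma E n) _ _ _ _ h01]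
  refine lintegral_congr_ae (ae_restrict_of_ae ?_)
  filter_upwards [exp_neg_llr h10, Measure.rnDeriv_lt_top (restrictLaw μ₀ n)
    (restrictLaw μ₁ n)] with x hx hx'
  rw [streamLLR, hx, ENNReal.ofReal_toReal hx'.ne]

end Stream

/-! ### Change of measure between joint laws -/

section Joint

variable {K : ℕ} {E : Fin K → Type*} [∀ k, MeasurableSpace (E k)]
  (P₀ P₁ : ∀ k, Measure (ℕ → E k))

/-- The log-likelihood ratio of the first `n` observations for the signal set `A` against `A'`. -/
noncomputable def setLLR (A A' : Finset (Fin K)) (n : ℕ) (ω : Obs E) : ℝ :=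
  ∑ k, ((if k ∈ A then (1 : ℝ) else 0) - if k ∈ A' then 1 else 0) * obsLLR P₀ P₁ n ω k

theorem measurable_obsLLR (n : ℕ) (k : Fin K) :
    Measurable[obsFiltration E n] fun ω => obsLLR P₀ P₁ n ω k :=
  (measurable_streamLLR (P₁ k) (P₀ k) n).comp
    (measurable_iff_comap_le.2
      (le_iSup (fun k => MeasurableSpace.comap (fun ω : Obs E => ω k) (streamSigma (E k) n)) k))

theorem measurable_setLLR (A A' : Finset (Fin K)) (n : ℕ) :
    Measurable[obsFiltration E n] (setLLR P₀ P₁ A A' n) :=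
  Finset.measurable_fun_sum _ fun k _ => (measurable_obsLLR P₀ P₁ n k).const_mul _

variable [∀ k, IsProbabilityMeasure (P₀ k)] [∀ k, IsProbabilityMeasure (P₁ k)]

instance isProbabilityMeasure_signalLaw (A : Finset (Fin K)) (k : Fin K) :
    IsProbabilityMeasure (if k ∈ A then P₁ k else P₀ k) := by
  split_ifs <;> infer_instance

instance isProbabilityMeasure_jointLaw (A : Finset (Fin K)) :
    IsProbabilityMeasure (jointLaw P₀ P₁ A) := by
  unfold jointLaw; infer_instance

/-- By independence the density is a product over streams: the factor is exp(λ) on A \ A', exp(-λ)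
on A' \ A, and 1 elsewhere, which is the exponential of `setLLR`. -/
theorem jointLaw_eq_setLIntegral (hequiv : ∀ k, LocallyEquivalent (P₁ k) (P₀ k))
    (A A' : Finset (Fin K)) {n : ℕ} (hn : 1 ≤ n) {G : Set (Obs E)}
    (hG : MeasurableSet[obsFiltration E n] G) :
    jointLaw P₀ P₁ A G =
      ∫⁻ ω in G, ENNReal.ofReal (Real.exp (setLLR P₀ P₁ A A' n ω)) ∂(jointLaw P₀ P₁ A') := by
  have h := pi_apply_eq_setLIntegral (fun k => streamSigma (E k) n) (fun k => streamSigma_le n)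
    (fun k => if k ∈ A' then P₁ k else P₀ k) (fun k => if k ∈ A then P₁ k else P₀ k)
    (fun k x => ENNReal.ofReal (Real.exp
      (((if k ∈ A then (1 : ℝ) else 0) - if k ∈ A' then 1 else 0) *
        streamLLR (P₁ k) (P₀ k) n x)))
    (fun k => (((measurable_streamLLR (P₁ k) (P₀ k) n).mono
      (streamSigma_le n) le_rfl).const_mul _).exp.ennreal_ofReal)
    (fun k B hB => by
      by_cases h1 : k ∈ A <;> by_cases h2 : k ∈ A' <;> simp only [h1, h2, if_true, if_false]
      · simp
      · simpa using exp_streamLLR_setLIntegral _ _ (hequiv k) hn hB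
      · simpa using exp_neg_streamLLR_setLIntegral _ _ (hequiv k) hn hB
      · simp) hG
  rw [jointLaw, h, jointLaw]
  refine lintegral_congr fun ω => ?_
  rw [setLLR, Real.exp_sum, ENNReal.ofReal_prod_of_nonneg fun _ _ => (Real.exp_pos _).le]
  rfl

/-- Where the log-likelihood ratio is at most C, the density is at most exp C. -/
theorem jointLaw_inter_le (hequiv : ∀ k, LocallyEquivalent (P₁ k) (P₀ k))
    (A A' : Finset (Fin K)) {n : ℕ} (hn : 1 ≤ n) {G : Set (Obs E)}
    (hG : MeasurableSet[obsFiltration E n] G) (C : ℝ) :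
    jointLaw P₀ P₁ A (G ∩ {ω | setLLR P₀ P₁ A A' n ω ≤ C}) ≤
      ENNReal.ofReal (Real.exp C) * jointLaw P₀ P₁ A' G := by
  have hS : MeasurableSet[obsFiltration E n] (G ∩ {ω | setLLR P₀ P₁ A A' n ω ≤ C}) :=
    hG.inter (measurable_setLLR P₀ P₁ A A' n measurableSet_Iic)
  rw [jointLaw_eq_setLIntegral P₀ P₁ hequiv A A' hn hS]
  calc _ ≤ ∫⁻ ω in G ∩ {ω | setLLR P₀ P₁ A A' n ω ≤ C}, ENNReal.ofReal (Real.exp C)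
        ∂(jointLaw P₀ P₁ A') :=
        setLIntegral_mono' ((obsFiltration E).le n _ hS) fun ω hω =>
          ENNReal.ofReal_le_ofReal (Real.exp_le_exp.2 hω.2)
    _ ≤ _ := by
        rw [setLIntegral_const]
        gcongr
        exact Set.inter_subset_left

/-- The law of a single stream under the joint law. -/
theorem jointLaw_preimage_eval (A : Finset (Fin K)) (k : Fin K) {B : Set (ℕ → E k)}
    (hB : MeasurableSet B) :
    jointLaw P₀ P₁ A {ω | ω k ∈ B} = (if k ∈ A then P₁ k else P₀ k) B :=
  (measurePreserving_eval (fun k => if k ∈ A then P₁ k else P₀ k) k).measure_preimage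
    hB.nullMeasurableSet

theorem ae_jointLaw_of_ae (A : Finset (Fin K)) (k : Fin K) {p : (ℕ → E k) → Prop}
    (hp : ∀ᵐ x ∂(if k ∈ A then P₁ k else P₀ k), p x) :
    ∀ᵐ ω ∂(jointLaw P₀ P₁ A), p (ω k) :=
  (measurePreserving_eval
    (fun k => if k ∈ A then P₁ k else P₀ k) k).quasiMeasurePreserving.ae hp

end Joint

/-! ### Growth of the log-likelihood ratio and lower bounds for random times -/

theorem LimsupRateLE.eventually_le {E : Type*} [MeasurableSpace E] {μ : Measure (ℕ → E)}
    {ξ : ℕ → (ℕ → E) → ℝ} {r : ℝ} (h : LimsupRateLE μ ξ r) {ε : ℝ} (hε : 0 < ε) :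
    ∀ᵐ x ∂μ, ∀ᶠ n : ℕ in atTop, ξ n x ≤ (r + ε) * n := by
  filter_upwards [h] with x hx
  have hlt : limsup (fun n : ℕ => ((ξ n x / n : ℝ) : EReal)) atTop < ((r + ε : ℝ) : EReal) :=
    hx.trans_lt (EReal.coe_lt_coe_iff.2 (by linarith))
  filter_upwards [eventually_lt_of_limsup_lt hlt, eventually_gt_atTop 0] with n hn hn0
  have hn0' : (0 : ℝ) < n := by exact_mod_cast hn0
  exact ((div_lt_iff₀ hn0').1 (EReal.coe_lt_coe_iff.1 hn)).le

section Joint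

variable {K : ℕ} {E : Fin K → Type*} [∀ k, MeasurableSpace (E k)]
  (P₀ P₁ : ∀ k, Measure (ℕ → E k))
  [∀ k, IsProbabilityMeasure (P₀ k)] [∀ k, IsProbabilityMeasure (P₁ k)]

/-- The asymptotic rate of the log-likelihood ratio of `A` against `A'` under the former. -/
noncomputable def divergenceRate (I J : Fin K → ℝ) (A A' : Finset (Fin K)) : ℝ :=
  ∑ k ∈ A \ A', I k + ∑ k ∈ A' \ A, J k

theorem divergenceRate_eq_sum (I J : Fin K → ℝ) (A A' : Finset (Fin K)) :
    divergenceRate I J A A' =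
      ∑ k, ((if k ∈ A \ A' then I k else 0) + if k ∈ A' \ A then J k else 0) := by
  rw [divergenceRate, Finset.sum_add_distrib, Finset.sum_ite_mem, Finset.sum_ite_mem,
    Finset.univ_inter, Finset.univ_inter]

/-- Only streams in the symmetric difference of A and A' contribute, and each obeys its own almost
sure limsup bound. -/
theorem ae_eventually_setLLR_le {I J : Fin K → ℝ}
    (hsup₁ : ∀ k, LimsupRateLE (P₁ k) (fun n => streamLLR (P₁ k) (P₀ k) n) (I k))
    (hsup₀ : ∀ k, LimsupRateLE (P₀ k) (fun n x => -streamLLR (P₁ k) (P₀ k) n x) (J k))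
    (A A' : Finset (Fin K)) {ε : ℝ} (hε : 0 < ε) :
    ∀ᵐ ω ∂(jointLaw P₀ P₁ A), ∀ᶠ n : ℕ in atTop,
      setLLR P₀ P₁ A A' n ω ≤ (divergenceRate I J A A' + ε) * n := by
  -- The slack is shared among the K streams; `K + 1` keeps the denominator positive when K = 0.
  set ε' : ℝ := ε / (K + 1) with hε'
  have hε'0 : 0 < ε' := by positivity
  have hstream : ∀ k, ∀ᵐ ω ∂(jointLaw P₀ P₁ A), ∀ᶠ n : ℕ in atTop,
      ((if k ∈ A then (1 : ℝ) else 0) - if k ∈ A' then 1 else 0) * obsLLR P₀ P₁ n ω k ≤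
        (((if k ∈ A \ A' then I k else 0) + if k ∈ A' \ A then J k else 0) + ε') * n := by
    intro k
    by_cases h1 : k ∈ A <;> by_cases h2 : k ∈ A'
    · refine Eventually.of_forall fun ω => Eventually.of_forall fun n => ?_
      simp only [h1, h2, if_true, Finset.mem_sdiff]
      simp only [sub_self, zero_mul, not_true, and_false, if_false, zero_add]
      positivity
    · have := ae_jointLaw_of_ae P₀ P₁ A k
        (p := fun x => ∀ᶠ n : ℕ in atTop, streamLLR (P₁ k) (P₀ k) n x ≤ (I k + ε') * n)
        (by rw [if_pos h1]; exact (hsup₁ k).eventually_le hε'0)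
      filter_upwards [this] with ω hω
      filter_upwards [hω] with n hn
      simpa [h1, h2, obsLLR] using hn
    · have := ae_jointLaw_of_ae P₀ P₁ A k
        (p := fun x => ∀ᶠ n : ℕ in atTop, -streamLLR (P₁ k) (P₀ k) n x ≤ (J k + ε') * n)
        (by rw [if_neg h1]; exact (hsup₀ k).eventually_le hε'0)
      filter_upwards [this] with ω hω
      filter_upwards [hω] with n hn
      simpa [h1, h2, obsLLR] using hn
    · refine Eventually.of_forall fun ω => Eventually.of_forall fun n => ?_
      simp only [h1, h2, if_false, Finset.mem_sdiff]
      simp only [sub_self, zero_mul, false_and, if_false, zero_add]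
      positivity
  filter_upwards [ae_all_iff.2 hstream] with ω hω
  filter_upwards [eventually_all.2 hω] with n hn
  refine (Finset.sum_le_sum fun k _ => hn k).trans ?_
  rw [← Finset.sum_mul, Finset.sum_add_distrib, ← divergenceRate_eq_sum]
  have : ∑ _k : Fin K, ε' ≤ ε := by
    rw [Finset.sum_const, Finset.card_univ, Fintype.card_fin, nsmul_eq_mul, hε', ← mul_div_assoc,
      div_le_iff₀ (by positivity)]
    nlinarith
  gcongr

/-- The log-likelihood ratio exceeds a level of slope larger than its rate with vanishing
probability, uniformly over the past. -/
theorem tendsto_measure_exists_setLLR_gt (A A' : Finset (Fin K)) {r C : ℝ} (hr : r < C)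
    (hC : 0 < C)
    (hrate : ∀ᵐ ω ∂(jointLaw P₀ P₁ A), ∀ᶠ n : ℕ in atTop, setLLR P₀ P₁ A A' n ω ≤ r * n) :
    Tendsto (fun n : ℕ => jointLaw P₀ P₁ A
      {ω | ∃ m ∈ Finset.Icc 1 n, C * n < setLLR P₀ P₁ A A' m ω}) atTop (𝓝 0) := by
  have hmeas : ∀ n : ℕ, MeasurableSet
      {ω | ∃ m ∈ Finset.Icc 1 n, C * n < setLLR P₀ P₁ A A' m ω} := by
    intro n
    have : {ω | ∃ m ∈ Finset.Icc 1 n, C * n < setLLR P₀ P₁ A A' m ω} =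
        ⋃ m ∈ Finset.Icc 1 n, {ω | C * n < setLLR P₀ P₁ A A' m ω} := by
      ext; simp
    rw [this]
    exact Finset.measurableSet_biUnion _ fun m _ =>
      (obsFiltration E).le m _ (measurable_setLLR P₀ P₁ A A' m measurableSet_Ioi)
  rw [← measure_empty (μ := jointLaw P₀ P₁ A)]
  refine tendsto_measure_of_ae_tendsto_indicator_of_isFiniteMeasure atTop MeasurableSet.empty
    hmeas ?_
  filter_upwards [hrate] with ω hω
  obtain ⟨M, hM⟩ := eventually_atTop.1 hω
  -- The finitely many values before the rate bound takes effect are bounded, hence eventually below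
  -- C n; the later ones are at most r m ≤ C n.
  obtain ⟨B, hB⟩ : ∃ B : ℝ, ∀ m ∈ Finset.range M, setLLR P₀ P₁ A A' m ω ≤ B := by
    obtain ⟨B, hB⟩ := ((Finset.range M).image fun m => setLLR P₀ P₁ A A' m ω).bddAbove
    exact ⟨B, fun m hm => hB (Finset.mem_coe.2 (Finset.mem_image_of_mem _ hm))⟩
  have hlim : Tendsto (fun n : ℕ => C * (n : ℝ)) atTop atTop :=
    tendsto_natCast_atTop_atTop.const_mul_atTop hC
  filter_upwards [hlim.eventually_ge_atTop B] with n hn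
  simp only [Set.mem_empty_iff_false, iff_false, not_exists, not_and, not_lt]
  intro m hm
  obtain ⟨-, hmn⟩ := Finset.mem_Icc.1 hm
  have hmn' : (m : ℝ) ≤ n := by exact_mod_cast hmn
  rcases lt_or_ge m M with h | h
  · exact (hB m (Finset.mem_range.2 h)).trans hn
  · calc _ ≤ r * m := hM m h
      _ ≤ C * m := by gcongr
      _ ≤ C * n := by gcongr

/-- The probability under `A` that a test stops early and does not fall into an event that is
rare under `A'`. -/
theorem jointLaw_le_time_le (hequiv : ∀ k, LocallyEquivalent (P₁ k) (P₀ k))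
    (A A' : Finset (Fin K)) (T : Obs E → ℕ∞) (hT1 : ∀ ω, 1 ≤ T ω) (S : Set (Obs E))
    (hS : ∀ m : ℕ, 1 ≤ m → MeasurableSet[obsFiltration E m] {ω | T ω = m ∧ ω ∈ S})
    (n : ℕ) (C : ℝ) :
    jointLaw P₀ P₁ A {ω | T ω ≤ n} ≤ jointLaw P₀ P₁ A Sᶜ +
      ENNReal.ofReal (Real.exp C) * jointLaw P₀ P₁ A' S +
      jointLaw P₀ P₁ A {ω | ∃ m ∈ Finset.Icc 1 n, C < setLLR P₀ P₁ A A' m ω} := by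
  have hsub : {ω | T ω ≤ n} ⊆ Sᶜ ∪ (⋃ m ∈ Finset.Icc 1 n,
      ({ω | T ω = m ∧ ω ∈ S} ∩ {ω | setLLR P₀ P₁ A A' m ω ≤ C})) ∪
      {ω | ∃ m ∈ Finset.Icc 1 n, C < setLLR P₀ P₁ A A' m ω} := by
    intro ω hω
    by_cases hωS : ω ∈ S
    · obtain ⟨m, hm⟩ : ∃ m : ℕ, T ω = m :=
        ⟨(T ω).toNat, (ENat.natCast_toNat (ne_top_of_le_ne_top (ENat.natCast_ne_top n) hω)).symm⟩
      have h1 : 1 ≤ m := by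
        have := hT1 ω; rw [hm] at this; exact_mod_cast this
      have h2 : m ≤ n := by
        have : T ω ≤ n := hω
        rw [hm] at this; exact_mod_cast this
      have hmem : m ∈ Finset.Icc 1 n := Finset.mem_Icc.2 ⟨h1, h2⟩
      rcases le_or_gt (setLLR P₀ P₁ A A' m ω) C with h | h
      · exact Or.inl (Or.inr (Set.mem_biUnion hmem ⟨⟨hm, hωS⟩, h⟩))
      · exact Or.inr ⟨m, hmem, h⟩
    · exact Or.inl (Or.inl hωS)
  refine (measure_mono hsub).trans ((measure_union_le _ _).trans ?_)
  gcongr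
  refine (measure_union_le _ _).trans ?_
  gcongr
  calc _ ≤ ∑ m ∈ Finset.Icc 1 n, jointLaw P₀ P₁ A
        ({ω | T ω = m ∧ ω ∈ S} ∩ {ω | setLLR P₀ P₁ A A' m ω ≤ C}) :=
        measure_biUnion_finset_le _ _
    _ ≤ ∑ m ∈ Finset.Icc 1 n, ENNReal.ofReal (Real.exp C) *
        jointLaw P₀ P₁ A' {ω | T ω = m ∧ ω ∈ S} :=
        Finset.sum_le_sum fun m hm => jointLaw_inter_le P₀ P₁ hequiv A A'
          (Finset.mem_Icc.1 hm).1 (hS m (Finset.mem_Icc.1 hm).1) C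
    _ = ENNReal.ofReal (Real.exp C) *
        jointLaw P₀ P₁ A' (⋃ m ∈ Finset.Icc 1 n, {ω | T ω = m ∧ ω ∈ S}) := by
        -- The events {T = m} are disjoint, so the factor exp C is paid once and not once for each
        -- m.
        rw [← Finset.mul_sum, measure_biUnion_finset]
        · intro i _ j _ hij
          refine Set.disjoint_left.2 fun ω hi hj => hij ?_
          exact_mod_cast hi.1.symm.trans hj.1
        · exact fun m hm => (obsFiltration E).le m _ (hS m (Finset.mem_Icc.1 hm).1)
    _ ≤ _ := by
        gcongr
        exact Set.iUnion₂_subset fun m _ ω hω => hω.2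

/-- Markov's inequality. The factor n + 1, available because T is integer-valued, later absorbs the
rounding down of n. -/
theorem mul_one_sub_le_lintegral_time {Ω : Type*} [MeasurableSpace Ω] (μ : Measure Ω)
    [IsProbabilityMeasure μ] (T : Ω → ℕ∞) (n : ℕ) (hT : MeasurableSet {ω | T ω ≤ n}) :
    ((n + 1 : ℕ) : ℝ≥0∞) * (1 - μ {ω | T ω ≤ n}) ≤ ∫⁻ ω, (T ω : ℝ≥0∞) ∂μ := by
  rw [← prob_compl_eq_one_sub hT, ← lintegral_indicator_const hT.compl]
  refine lintegral_mono fun ω => ?_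
  by_cases h : T ω ≤ n
  · rw [Set.indicator_of_notMem (by simpa using h)]
    exact zero_le
  · rw [Set.indicator_of_mem (by simpa using h)]
    have h' : ((n + 1 : ℕ) : ℕ∞) ≤ T ω := by
      push_cast
      exact Order.add_one_le_of_lt (not_le.1 h)
    rw [← ENat.toENNReal_coe]
    exact ENat.toENNReal_le.2 h'

/-- Uniform asymptotic lower bound for the expectation of random times with which an event that
is likely under `A` and rare under `A'` is decided upon. -/
theorem eventually_le_lintegral_time (hequiv : ∀ k, LocallyEquivalent (P₁ k) (P₀ k))
    (A A' : Finset (Fin K)) {R : ℝ} (hR : 0 < R)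
    (hrate : ∀ ε : ℝ, 0 < ε → ∀ᵐ ω ∂(jointLaw P₀ P₁ A), ∀ᶠ n : ℕ in atTop,
      setLLR P₀ P₁ A A' n ω ≤ (R + ε) * n)
    {ι : Type*} {L : Filter ι} (γ η : ι → ℝ) (hγ : Tendsto γ L (𝓝[>] 0))
    (hη : Tendsto η L (𝓝[>] 0)) {δ : ℝ} (hδ : 0 < δ) (hδ1 : δ < 1) :
    ∀ᶠ p in L, ∀ (T : Obs E → ℕ∞) (S : Set (Obs E)), (∀ ω, 1 ≤ T ω) →
      (∀ m : ℕ, MeasurableSet {ω | T ω ≤ m}) →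
      (∀ m : ℕ, 1 ≤ m → MeasurableSet[obsFiltration E m] {ω | T ω = m ∧ ω ∈ S}) →
      jointLaw P₀ P₁ A Sᶜ ≤ ENNReal.ofReal (η p) →
      jointLaw P₀ P₁ A' S ≤ ENNReal.ofReal (γ p) →
      ENNReal.ofReal ((1 - δ) * (|Real.log (γ p)| * R⁻¹)) ≤
        ∫⁻ ω, (T ω : ℝ≥0∞) ∂(jointLaw P₀ P₁ A) := by
  -- With slope C = R (1 + θ) and horizon N at most (1 - θ) |log γ| / R, one has C N ≤ (1 - θ²) |log
  -- γ|, so exp(C N) γ ≤ exp(-θ² |log γ|) tends to 0. Stopping by N then has probability at most θ,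
  -- and the loss (1 - θ)² is at least 1 - 2θ = 1 - δ.
  set θ : ℝ := δ / 2 with hθ
  have hθ0 : 0 < θ := by positivity
  have hθ1 : θ < 1 := by linarith
  set C : ℝ := R * (1 + θ) with hC
  have hC0 : 0 < C := by positivity
  set N : ι → ℕ := fun p => ⌊(1 - θ) * (|Real.log (γ p)| * R⁻¹)⌋₊ with hN
  have hlog : Tendsto (fun p => |Real.log (γ p)|) L atTop :=
    (tendsto_abs_atBot_atTop.comp Real.tendsto_log_nhdsGT_zero).comp hγ
  have hNlim : Tendsto N L atTop :=
    tendsto_nat_floor_atTop.comp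
      ((hlog.atTop_mul_const (inv_pos.2 hR)).const_mul_atTop (by linarith))
  have hexceed : Tendsto (fun p => jointLaw P₀ P₁ A
      {ω | ∃ m ∈ Finset.Icc 1 (N p), C * N p < setLLR P₀ P₁ A A' m ω}) L (𝓝 0) :=
    (tendsto_measure_exists_setLLR_gt P₀ P₁ A A' (r := R + R * θ / 2) (C := C)
      (by rw [hC]; nlinarith [mul_pos hR hθ0]) hC0 (hrate _ (by positivity))).comp hNlim
  have hexp : Tendsto (fun p => ENNReal.ofReal (Real.exp (-(θ ^ 2 * |Real.log (γ p)|)))) L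
      (𝓝 0) := by
    rw [← ENNReal.ofReal_zero]
    exact ENNReal.tendsto_ofReal (Real.tendsto_exp_neg_atTop_nhds_zero.comp
      (hlog.const_mul_atTop (by positivity)))
  have hη0 : Tendsto (fun p => ENNReal.ofReal (η p)) L (𝓝 0) := by
    rw [← ENNReal.ofReal_zero]
    exact ENNReal.tendsto_ofReal (hη.mono_right nhdsWithin_le_nhds)
  have hsum := (hη0.add hexp).add hexceed
  rw [add_zero, add_zero] at hsum
  have hθE : (0 : ℝ≥0∞) < ENNReal.ofReal θ := ENNReal.ofReal_pos.2 hθ0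
  have hγ1 : ∀ᶠ p in L, γ p ∈ Set.Ioo (0 : ℝ) 1 :=
    hγ.eventually (Ioo_mem_nhdsGT one_pos)
  filter_upwards [hsum.eventually_lt_const hθE, hγ1] with p hp hγp T S hT1 hTm hS hA hA'
  have hlogp : Real.log (γ p) = -|Real.log (γ p)| := by
    rw [abs_of_neg (Real.log_neg hγp.1 hγp.2), neg_neg]
  have hfloor : (N p : ℝ) ≤ (1 - θ) * (|Real.log (γ p)| * R⁻¹) :=
    Nat.floor_le (mul_nonneg (by linarith) (by positivity))
  have hfloor' : (1 - θ) * (|Real.log (γ p)| * R⁻¹) ≤ ((N p + 1 : ℕ) : ℝ) := by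
    push_cast
    exact (Nat.lt_floor_add_one _).le
  have hchange : ENNReal.ofReal (Real.exp (C * N p)) * jointLaw P₀ P₁ A' S ≤
      ENNReal.ofReal (Real.exp (-(θ ^ 2 * |Real.log (γ p)|))) := by
    calc _ ≤ ENNReal.ofReal (Real.exp (C * N p)) * ENNReal.ofReal (γ p) := by gcongr
      _ = ENNReal.ofReal (Real.exp (C * N p + Real.log (γ p))) := by
        rw [← ENNReal.ofReal_mul (Real.exp_pos _).le, Real.exp_add, Real.exp_log hγp.1]
      _ ≤ _ := by
        refine ENNReal.ofReal_le_ofReal (Real.exp_le_exp.2 ?_)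
        rw [hlogp]
        have h1 : C * N p ≤ C * ((1 - θ) * (|Real.log (γ p)| * R⁻¹)) := by gcongr
        have h2 : C * ((1 - θ) * (|Real.log (γ p)| * R⁻¹)) =
            (1 - θ ^ 2) * |Real.log (γ p)| := by
          rw [hC]; field_simp; ring
        rw [abs_neg, abs_abs]
        linarith
  have hearly : jointLaw P₀ P₁ A {ω | T ω ≤ N p} ≤ ENNReal.ofReal θ := by
    refine (jointLaw_le_time_le P₀ P₁ hequiv A A' T hT1 S hS (N p) (C * N p)).trans ?_
    refine le_trans ?_ hp.le
    gcongr
  refine le_trans ?_ (mul_one_sub_le_lintegral_time (jointLaw P₀ P₁ A) T (N p) (hTm (N p)))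
  calc ENNReal.ofReal ((1 - δ) * (|Real.log (γ p)| * R⁻¹))
      ≤ ENNReal.ofReal (((N p + 1 : ℕ) : ℝ) * (1 - θ)) := by
        refine ENNReal.ofReal_le_ofReal ?_
        have h1 : ((1 - θ) * (|Real.log (γ p)| * R⁻¹)) * (1 - θ) ≤
            ((N p + 1 : ℕ) : ℝ) * (1 - θ) :=
          mul_le_mul_of_nonneg_right hfloor' (by linarith)
        have h2 : 0 ≤ |Real.log (γ p)| * R⁻¹ := by positivity
        nlinarith [mul_nonneg h2 (sq_nonneg θ)]
    _ = ((N p + 1 : ℕ) : ℝ≥0∞) * (1 - ENNReal.ofReal θ) := by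
        rw [ENNReal.ofReal_mul (by positivity), ENNReal.ofReal_natCast,
          ENNReal.ofReal_sub _ hθ0.le, ENNReal.ofReal_one]
    _ ≤ _ := by gcongr

end Joint

/-! ### Stopping along a fixed trajectory -/

section Deterministic

variable {K : ℕ}

theorem le_orderStat (x : Fin K → ℝ) {A : Finset (Fin K)} {p : ℝ} (hp : ∀ i ∈ A, p ≤ x i)
    {r : ℕ} (hr : r ≤ A.card) : (p : EReal) ≤ orderStat x r := by
  refine le_sSup (hr.trans (Finset.card_le_card fun i hi => ?_))
  simpa using hp i hi

/-- A level above q can be reached only inside A, hence by fewer than r streams. -/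
theorem orderStat_le (x : Fin K → ℝ) {A : Finset (Fin K)} {q : ℝ} (hq : ∀ j, j ∉ A → x j ≤ q)
    {r : ℕ} (hr : A.card < r) : orderStat x r ≤ (q : EReal) := by
  refine sSup_le fun t ht => ?_
  by_contra! hlt
  have ht' : r ≤ (Finset.univ.filter fun k => t ≤ (x k : EReal)).card := ht
  refine absurd (ht'.trans (Finset.card_le_card (t := A) fun k hk => ?_)) (not_le.2 hr)
  by_contra hkA
  have h1 : t ≤ (x k : EReal) := (Finset.mem_filter.1 hk).2
  exact absurd (hlt.trans_le h1) (not_lt.2 (EReal.coe_le_coe_iff.2 (hq k hkA)))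

theorem numPos_eq_card (x : Fin K → ℝ) {A : Finset (Fin K)} (hp : ∀ i ∈ A, 0 < x i)
    (hq : ∀ j, j ∉ A → x j ≤ 0) : numPos x = A.card := by
  refine congrArg Finset.card (Finset.ext fun k => ?_)
  simp only [Finset.mem_filter, Finset.mem_univ, true_and]
  refine ⟨fun h => ?_, hp k⟩
  by_contra hk
  exact absurd h (not_lt.2 (hq k hk))

theorem firstTime_le {P : ℕ → Prop} {n : ℕ} (hn : 1 ≤ n) (h : P n) : firstTime P ≤ n :=
  iInf₂_le n ⟨hn, h⟩

/-- The |A|-th largest value is at least p and the next one at most -q, so the gap is at least p +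
q. If l = u this triggers the gap rule; otherwise τ₁ applies when |A| = l, τ₃ when |A| = u, and τ₂
strictly in between. -/
theorem syncTime_le_of_separated {l u : ℕ} {a b c d : ℝ} {x : ℕ → Fin K → ℝ} {n : ℕ}
    (hn : 1 ≤ n) {A : Finset (Fin K)} (hlA : l ≤ A.card) (hAu : A.card ≤ u) {p q : ℝ}
    (hp0 : 0 < p) (hq0 : 0 < q)
    (hp : ∀ i ∈ A, p ≤ x n i) (hq : ∀ j, j ∉ A → x n j ≤ -q)
    (hα : (if A.card = l then c else a) ≤ p + if A.card = l then q else 0)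
    (hβ : (if A.card = u then d else b) ≤ q + if A.card = u then p else 0) :
    syncTime l u a b c d x ≤ n := by
  unfold syncTime
  have hlow : ((p : ℝ) : EReal) ≤ orderStat (x n) A.card := le_orderStat _ hp le_rfl
  have hupp : orderStat (x n) (A.card + 1) ≤ ((-q : ℝ) : EReal) :=
    orderStat_le _ hq (Nat.lt_succ_self _)
  by_cases hlu : l = u
  · have hl : A.card = l := le_antisymm (hlu ▸ hAu) hlA
    rw [if_pos hlu]
    refine firstTime_le hn ?_
    simp only [hl, ← hlu, if_true] at hα hβ hlow hupp
    refine le_trans ?_ (EReal.sub_le_sub hlow hupp)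
    rw [← EReal.coe_sub, EReal.coe_le_coe_iff]
    exact max_le (by linarith) (by linarith)
  rw [if_neg hlu]
  by_cases hl : A.card = l
  · have hu : A.card ≠ u := fun h => hlu (hl.symm.trans h)
    refine (min_le_left _ _).trans (firstTime_le hn ?_)
    simp only [hl, if_true] at hα hlow hupp
    simp only [hu, if_false] at hβ
    refine hupp.trans (le_min ?_ ?_)
    · rw [← EReal.coe_neg, EReal.coe_le_coe_iff]; linarith
    · refine le_trans ?_ (add_le_add_right hlow _)
      rw [← EReal.coe_neg, ← EReal.coe_add, EReal.coe_le_coe_iff]; linarith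
  by_cases hu : A.card = u
  · refine (min_le_right _ _).trans ((min_le_right _ _).trans (firstTime_le hn ?_))
    simp only [hu, if_true] at hβ hlow hupp
    simp only [hl, if_false] at hα
    refine le_trans (max_le ?_ ?_) hlow
    · rw [EReal.coe_le_coe_iff]; linarith
    · refine (add_le_add_right hupp _).trans ?_
      rw [← EReal.coe_add, EReal.coe_le_coe_iff]; linarith
  · simp only [hl, hu, if_false, add_zero] at hα hβ
    refine (min_le_right _ _).trans ((min_le_left _ _).trans (firstTime_le hn ⟨fun k => ?_, ?_⟩))
    · by_cases hk : k ∈ A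
      · exact fun h => absurd h.2 (not_lt.2 (hα.trans (hp k hk)))
      · exact fun h => absurd h.1 (not_lt.2 ((hq k hk).trans (neg_le_neg hβ)))
    · rw [numPos_eq_card _ (fun i hi => hp0.trans_le (hp i hi))
        fun j hj => (hq j hj).trans (by linarith)]
      exact ⟨hlA, hAu⟩

/-- `syncTime_le_of_separated` with the requirement on the thresholds for signals (noises) dropped if there are no
signals (noises). -/
theorem syncTime_le_of_separated_of_nonempty {l u : ℕ} (hu : 0 < u) (hl : l < K) {a b c d : ℝ}
    {x : ℕ → Fin K → ℝ} {n : ℕ}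
    (hn : 1 ≤ n) {A : Finset (Fin K)} (hlA : l ≤ A.card) (hAu : A.card ≤ u) {p q : ℝ}
    (hp0 : 0 < p) (hq0 : 0 < q)
    (hp : ∀ i ∈ A, p ≤ x n i) (hq : ∀ j, j ∉ A → x n j ≤ -q)
    (hα : A.Nonempty → (if A.card = l then c else a) ≤ p + if A.card = l then q else 0)
    (hβ : Aᶜ.Nonempty → (if A.card = u then d else b) ≤ q + if A.card = u then p else 0) :
    syncTime l u a b c d x ≤ n := by
  rcases A.eq_empty_or_nonempty with rfl | hA
  · have hne : ((∅ : Finset (Fin K))ᶜ).Nonempty := by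
      rw [Finset.compl_empty]; exact ⟨⟨0, Nat.zero_lt_of_lt hl⟩, Finset.mem_univ _⟩
    have hu0 : ¬ (∅ : Finset (Fin K)).card = u := by simpa using hu.ne
    -- Without signals p is free and can be raised above `a` and `c`; it does not enter the
    -- requirement for noises, because |A| = 0 < u.
    refine syncTime_le_of_separated hn hlA hAu (p := max p (max a c)) (lt_max_of_lt_left hp0) hq0
      (by simp) hq ?_ ?_
    · have h1 := le_max_right p (max a c)
      have h2 := (le_max_left a c).trans h1
      have h3 := (le_max_right a c).trans h1
      split_ifs <;> linarith
    · have := hβ hne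
      rwa [if_neg hu0, if_neg hu0] at this ⊢
  rcases (Aᶜ).eq_empty_or_nonempty with hc | hc
  · have hcard : A.card = K := by
      rw [(Finset.compl_eq_empty_iff A).1 hc, Finset.card_univ, Fintype.card_fin]
    have hl0 : ¬ A.card = l := by rw [hcard]; exact hl.ne'
    -- Without noises q is free, and it does not enter the requirement for signals, because |A| = K
    -- > l.
    refine syncTime_le_of_separated hn hlA hAu (q := max q (max b d)) hp0 (lt_max_of_lt_left hq0)
      hp ?_ ?_ ?_
    · intro j hj
      exact absurd (Finset.mem_compl.2 hj) (by simp [hc])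
    · have := hα hA
      rwa [if_neg hl0, if_neg hl0] at this ⊢
    · have h1 := le_max_right q (max b d)
      have h2 := (le_max_left b d).trans h1
      have h3 := (le_max_right b d).trans h1
      split_ifs <;> linarith
  · exact syncTime_le_of_separated hn hlA hAu hp0 hq0 hp hq (hα hA) (hβ hc)

theorem minOver_empty (r : Fin K → ℝ) : minOver r ∅ = ⊤ := by simp [minOver]

theorem exists_minOver_eq (r : Fin K → ℝ) {S : Finset (Fin K)} (hS : S.Nonempty) :
    ∃ i ∈ S, minOver r S = ENNReal.ofReal (r i) ∧ ∀ k ∈ S, r i ≤ r k := by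
  obtain ⟨i, hi, hmin⟩ := S.exists_min_image r hS
  exact ⟨i, hi, le_antisymm (iInf₂_le i hi)
    (le_iInf₂ fun k hk => ENNReal.ofReal_le_ofReal (hmin k hk)), hmin⟩

/-- The coefficient of `|log α|` in `syncRate`. -/
noncomputable def signalWeight (I J : Fin K → ℝ) (l : ℕ) (A : Finset (Fin K)) : ℝ :=
  ((minOver I A + if A.card = l then minOver J Aᶜ else 0)⁻¹).toReal

/-- The coefficient of `|log β|` in `syncRate`. -/
noncomputable def noiseWeight (I J : Fin K → ℝ) (u : ℕ) (A : Finset (Fin K)) : ℝ :=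
  ((minOver J Aᶜ + if A.card = u then minOver I A else 0)⁻¹).toReal

theorem compl_nonempty_of_card_lt {A : Finset (Fin K)} (h : A.card < K) : Aᶜ.Nonempty := by
  rw [← Finset.card_pos, Finset.card_compl, Fintype.card_fin]; omega

section Weights

variable {I J : Fin K → ℝ} {l u : ℕ} {A : Finset (Fin K)}

theorem signalWeight_nonneg : 0 ≤ signalWeight I J l A := ENNReal.toReal_nonneg

theorem noiseWeight_nonneg : 0 ≤ noiseWeight I J u A := ENNReal.toReal_nonneg

/-- The denominator is infinite: without signals, α imposes no delay. -/
theorem signalWeight_empty : signalWeight I J l ∅ = 0 := by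
  simp [signalWeight, minOver_empty]

theorem noiseWeight_of_compl_eq_empty (h : Aᶜ = ∅) : noiseWeight I J u A = 0 := by
  simp [noiseWeight, h, minOver_empty]

/-- Minimisers are named explicitly because they are the streams altered in the lower bound. When
|A| = l < K, there is a noise to attain the minimum of J. -/
theorem exists_signalWeight_eq (hI : ∀ k, 0 < I k) (hJ : ∀ k, 0 < J k) (hl : l < K)
    (hA : A.Nonempty) :
    ∃ i ∈ A, (∀ k ∈ A, I i ≤ I k) ∧
      if A.card = l then ∃ j ∈ Aᶜ, (∀ k ∈ Aᶜ, J j ≤ J k) ∧ signalWeight I J l A = (I i + J j)⁻¹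
      else signalWeight I J l A = (I i)⁻¹ := by
  obtain ⟨i, hi, hIi, hmin⟩ := exists_minOver_eq I hA
  refine ⟨i, hi, hmin, ?_⟩
  split_ifs with h
  · obtain ⟨j, hj, hJj, hminj⟩ :=
      exists_minOver_eq J (compl_nonempty_of_card_lt (A := A) (by rw [h]; exact hl))
    refine ⟨j, hj, hminj, ?_⟩
    rw [signalWeight, if_pos h, hIi, hJj, ← ENNReal.ofReal_add (hI i).le (hJ j).le,
      ENNReal.toReal_inv, ENNReal.toReal_ofReal (add_pos (hI i) (hJ j)).le]
  · rw [signalWeight, if_neg h, add_zero, hIi, ENNReal.toReal_inv,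
      ENNReal.toReal_ofReal (hI i).le]

theorem exists_noiseWeight_eq (hI : ∀ k, 0 < I k) (hJ : ∀ k, 0 < J k) (hu : 0 < u)
    (hA : Aᶜ.Nonempty) :
    ∃ j ∈ Aᶜ, (∀ k ∈ Aᶜ, J j ≤ J k) ∧
      if A.card = u then ∃ i ∈ A, (∀ k ∈ A, I i ≤ I k) ∧ noiseWeight I J u A = (J j + I i)⁻¹
      else noiseWeight I J u A = (J j)⁻¹ := by
  obtain ⟨j, hj, hJj, hmin⟩ := exists_minOver_eq J hA
  refine ⟨j, hj, hmin, ?_⟩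
  split_ifs with h
  · obtain ⟨i, hi, hIi, hmini⟩ :=
      exists_minOver_eq I (Finset.card_pos.1 (by rw [h]; exact hu) : A.Nonempty)
    refine ⟨i, hi, hmini, ?_⟩
    rw [noiseWeight, if_pos h, hIi, hJj, ← ENNReal.ofReal_add (hJ j).le (hI i).le,
      ENNReal.toReal_inv, ENNReal.toReal_ofReal (add_pos (hJ j) (hI i)).le]
  · rw [noiseWeight, if_neg h, add_zero, hJj, ENNReal.toReal_inv,
      ENNReal.toReal_ofReal (hJ j).le]

theorem signalWeight_pos (hI : ∀ k, 0 < I k) (hJ : ∀ k, 0 < J k) (hl : l < K)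
    (hA : A.Nonempty) : 0 < signalWeight I J l A := by
  obtain ⟨i, -, -, h⟩ := exists_signalWeight_eq hI hJ hl hA
  split_ifs at h
  · obtain ⟨j, -, -, hw⟩ := h
    rw [hw]; exact inv_pos.2 (add_pos (hI i) (hJ j))
  · rw [h]; exact inv_pos.2 (hI i)

theorem noiseWeight_pos (hI : ∀ k, 0 < I k) (hJ : ∀ k, 0 < J k) (hu : 0 < u)
    (hA : Aᶜ.Nonempty) : 0 < noiseWeight I J u A := by
  obtain ⟨j, -, -, h⟩ := exists_noiseWeight_eq hI hJ hu hA
  split_ifs at h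
  · obtain ⟨i, -, -, hw⟩ := h
    rw [hw]; exact inv_pos.2 (add_pos (hJ j) (hI i))
  · rw [h]; exact inv_pos.2 (hJ j)

theorem ofReal_div_eq_of_ne_zero {x : ℝ≥0∞} (hx : x ≠ 0) (t : ℝ) :
    ENNReal.ofReal |t| / x = ENNReal.ofReal (|t| * (x⁻¹).toReal) := by
  rw [ENNReal.ofReal_mul (abs_nonneg t), ENNReal.ofReal_toReal (ENNReal.inv_ne_top.2 hx),
    div_eq_mul_inv]

theorem minOver_ne_zero {r : Fin K → ℝ} (hr : ∀ k, 0 < r k) (S : Finset (Fin K)) :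
    minOver r S ≠ 0 := by
  rcases S.eq_empty_or_nonempty with rfl | hS
  · simp [minOver_empty]
  · obtain ⟨i, -, h, -⟩ := exists_minOver_eq r hS
    rw [h]; exact (ENNReal.ofReal_pos.2 (hr i)).ne'

theorem syncRate_eq (hI : ∀ k, 0 < I k) (hJ : ∀ k, 0 < J k) (α β : ℝ) :
    syncRate I J l u A α β = ENNReal.ofReal
      (max (|Real.log α| * signalWeight I J l A) (|Real.log β| * noiseWeight I J u A)) := by
  rw [syncRate, ENNReal.ofReal_max, ofReal_div_eq_of_ne_zero, ofReal_div_eq_of_ne_zero]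
  · rfl
  · exact fun h => minOver_ne_zero hJ _ (add_eq_zero.1 h).1
  · exact fun h => minOver_ne_zero hI _ (add_eq_zero.1 h).1

/-- The rule stops by time `n` if all the log-likelihood ratios have grown at least at rate
`1 - ε` and the thresholds are small compared with `n`. -/
theorem syncTime_le_of_growth (hI : ∀ k, 0 < I k) (hJ : ∀ k, 0 < J k) (hu : 0 < u) (hl : l < K)
    (hlA : l ≤ A.card) (hAu : A.card ≤ u) {a b c d ε : ℝ} (hε : ε < 1)
    {x : ℕ → Fin K → ℝ} {n : ℕ} (hn : 1 ≤ n)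
    (hp : ∀ i ∈ A, (1 - ε) * I i * n ≤ x n i) (hq : ∀ j, j ∉ A → (1 - ε) * J j * n ≤ -x n j)
    (hα : (if A.card = l then c else a) * signalWeight I J l A ≤ (1 - ε) * n)
    (hβ : (if A.card = u then d else b) * noiseWeight I J u A ≤ (1 - ε) * n) :
    syncTime l u a b c d x ≤ n := by
  have hε' : 0 < 1 - ε := by linarith
  have hn' : (0 : ℝ) < n := by exact_mod_cast hn
  have hmin : ∀ {r : Fin K → ℝ}, (∀ k, 0 < r k) → ∀ S : Finset (Fin K),
      ∃ m : ℝ, 0 < m ∧ (∀ k ∈ S, m ≤ r k) ∧ ∀ i ∈ S, (∀ k ∈ S, r i ≤ r k) → r i = m := by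
    intro r hr S
    rcases S.eq_empty_or_nonempty with rfl | hS
    -- Any positive value serves here: over an empty set the corresponding requirement is void.
    · exact ⟨1, one_pos, by simp, by simp⟩
    · obtain ⟨i, hi, -, hmin⟩ := exists_minOver_eq r hS
      exact ⟨r i, hr i, hmin, fun j hj hj' => le_antisymm (hj' i hi) (hmin j hj)⟩
  obtain ⟨mI, hmI0, hmI, hmI'⟩ := hmin hI A
  obtain ⟨mJ, hmJ0, hmJ, hmJ'⟩ := hmin hJ Aᶜ
  refine syncTime_le_of_separated_of_nonempty hu hl hn hlA hAu (p := (1 - ε) * mI * n)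
    (q := (1 - ε) * mJ * n) (by positivity) (by positivity) (fun i hi => ?_) (fun j hj => ?_)
    (fun hA => ?_) (fun hA => ?_)
  · refine le_trans ?_ (hp i hi)
    have := hmI i hi
    gcongr
  · have h1 := hq j hj
    have h2 : (1 - ε) * mJ * n ≤ (1 - ε) * J j * n := by
      have := hmJ j (Finset.mem_compl.2 hj)
      gcongr
    linarith
  · obtain ⟨i, hi, hi', h⟩ := exists_signalWeight_eq hI hJ hl hA
    rw [hmI' i hi hi'] at h
    by_cases hc : A.card = l
    · simp only [if_pos hc] at h hα ⊢
      obtain ⟨j, hj, hj', h⟩ := h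
      rw [hmJ' j hj hj'] at h
      rw [h, mul_inv_le_iff₀ (by positivity)] at hα
      linarith
    · simp only [if_neg hc] at h hα ⊢
      rw [h, mul_inv_le_iff₀ (by positivity)] at hα
      linarith
  · obtain ⟨j, hj, hj', h⟩ := exists_noiseWeight_eq hI hJ hu hA
    rw [hmJ' j hj hj'] at h
    by_cases hc : A.card = u
    · simp only [if_pos hc] at h hβ ⊢
      obtain ⟨i, hi, hi', h⟩ := h
      rw [hmI' i hi hi'] at h
      rw [h, mul_inv_le_iff₀ (by positivity)] at hβ
      linarith
    · simp only [if_neg hc] at h hβ ⊢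
      rw [h, mul_inv_le_iff₀ (by positivity)] at hβ
      linarith

end Weights

/-- Every n from N up to, but excluding, t must be bad, so t exceeds N by at most the number of bad
times. -/
theorem time_le_add_tsum_indicator {t : ℕ∞} {bad : ℕ → Prop} [DecidablePred bad] {N : ℕ}
    (h : ∀ n, N ≤ n → ¬ bad n → t ≤ n) :
    (t : ℝ≥0∞) ≤ N + ∑' n, if bad n then 1 else 0 := by
  have key : ∀ m : ℕ, (m : ℕ∞) < t → ((m + 1 : ℕ) : ℝ≥0∞) ≤ N + ∑' n, if bad n then 1 else 0 := by
    intro m hm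
    have hbad : ∀ n ∈ Finset.Ico N (m + 1), bad n := by
      intro n hn
      obtain ⟨h1, h2⟩ := Finset.mem_Ico.1 hn
      by_contra hb
      have h3 : (n : ℕ∞) ≤ m := by exact_mod_cast Nat.lt_succ_iff.1 h2
      exact absurd (hm.trans_le ((h n h1 hb).trans h3)) (lt_irrefl _)
    calc ((m + 1 : ℕ) : ℝ≥0∞) ≤ ((N + (m + 1 - N) : ℕ) : ℝ≥0∞) := by
          exact_mod_cast (by omega : m + 1 ≤ N + (m + 1 - N))
      _ = N + ∑ n ∈ Finset.Ico N (m + 1), if bad n then 1 else 0 := by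
          rw [Finset.sum_congr rfl fun n hn => if_pos (hbad n hn)]
          simp
      _ ≤ _ := by
          gcongr
          exact ENNReal.sum_le_tsum _
  induction t using ENat.recTopCoe with
  | top =>
    by_contra! hlt
    obtain ⟨m, hm⟩ := ENNReal.exists_nat_gt hlt.ne_top
    refine absurd ((key m (ENat.natCast_lt_top m)).trans_lt hm) (not_lt.2 ?_)
    exact_mod_cast Nat.le_succ m
  | coe t =>
    rcases t with _ | m
    · simp
    · rw [ENat.toENNReal_coe]
      exact key m (by exact_mod_cast Nat.lt_succ_self m)

end Deterministic

/-! ### Upper bound for the expected stopping time -/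

section Joint

variable {K : ℕ} {E : Fin K → Type*} [∀ k, MeasurableSpace (E k)]
  (P₀ P₁ : ∀ k, Measure (ℕ → E k))
  [∀ k, IsProbabilityMeasure (P₀ k)] [∀ k, IsProbabilityMeasure (P₁ k)]

/-- Up to a constant, the expected stopping time is at most the time needed to reach the
thresholds at rate `1 - ε`. -/
theorem exists_expectedTime_le {I J : Fin K → ℝ} (hI : ∀ k, 0 < I k) (hJ : ∀ k, 0 < J k)
    (hcc₁ : ∀ k, CompleteLowerRate (P₁ k) (fun n => streamLLR (P₁ k) (P₀ k) n) (I k))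
    (hcc₀ : ∀ k, CompleteLowerRate (P₀ k) (fun n x => -streamLLR (P₁ k) (P₀ k) n x) (J k))
    {l u : ℕ} (hu : 0 < u) (hl : l < K) {A : Finset (Fin K)}
    (hlA : l ≤ A.card) (hAu : A.card ≤ u) {ε : ℝ} (hε0 : 0 < ε) (hε : ε < 1) :
    ∃ B : ℝ, 0 ≤ B ∧ ∀ (a b c d : ℝ) (k : Fin K),
      (syncTest P₀ P₁ l u a b c d).expectedTime P₀ P₁ A k ≤ ENNReal.ofReal
        (max (max ((if A.card = l then c else a) * signalWeight I J l A)
          ((if A.card = u then d else b) * noiseWeight I J u A)) 0 / (1 - ε) + B) := by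
  classical
  set μ := jointLaw P₀ P₁ A with hμ
  set S : ℕ → (k : Fin K) → Set (ℕ → E k) := fun n k =>
    if k ∈ A then {x | streamLLR (P₁ k) (P₀ k) n x ≤ (1 - ε) * I k * n}
    else {x | -streamLLR (P₁ k) (P₀ k) n x ≤ (1 - ε) * J k * n} with hS
  have hSmeas : ∀ n k, MeasurableSet (S n k) := by
    intro n k
    have hm := (measurable_streamLLR (P₁ k) (P₀ k) n).mono (streamSigma_le n) le_rfl
    simp only [hS]
    split_ifs
    · exact hm measurableSet_Iic
    · exact hm.neg measurableSet_Iic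
  set bad : Obs E → ℕ → Prop := fun ω n => ∃ k, ω k ∈ S n k with hbad
  have hbadset : ∀ n, {ω | bad ω n} = ⋃ k, {ω : Obs E | ω k ∈ S n k} := by
    intro n; ext ω; simp [hbad]
  have hbadmeas : ∀ n, MeasurableSet {ω | bad ω n} := by
    intro n
    rw [hbadset]
    exact MeasurableSet.iUnion fun k => measurable_pi_apply k (hSmeas n k)
  have hstream : ∀ k, ∑' n : ℕ, μ {ω : Obs E | ω k ∈ S (n + 1) k} < ⊤ := by
    intro k
    have heq : ∀ n, μ {ω : Obs E | ω k ∈ S n k} = (if k ∈ A then P₁ k else P₀ k) (S n k) :=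
      fun n => jointLaw_preimage_eval P₀ P₁ A k (hSmeas n k)
    rw [tsum_congr fun n => heq (n + 1)]
    simp only [hS]
    by_cases hk : k ∈ A
    · simp only [if_pos hk]
      refine lt_of_le_of_lt (ENNReal.tsum_le_tsum fun n => measure_mono ?_)
        (hcc₁ k (ε * I k) (mul_pos hε0 (hI k)))
      intro x hx
      have hx' : streamLLR (P₁ k) (P₀ k) (n + 1) x ≤ (1 - ε) * I k * ((n + 1 : ℕ) : ℝ) := hx
      have : streamLLR (P₁ k) (P₀ k) (n + 1) x / ((n + 1 : ℕ) : ℝ) ≤ I k - ε * I k := by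
        rw [div_le_iff₀ (by positivity)]
        linarith
      exact this
    · simp only [if_neg hk]
      refine lt_of_le_of_lt (ENNReal.tsum_le_tsum fun n => measure_mono ?_)
        (hcc₀ k (ε * J k) (mul_pos hε0 (hJ k)))
      intro x hx
      have hx' : -streamLLR (P₁ k) (P₀ k) (n + 1) x ≤ (1 - ε) * J k * ((n + 1 : ℕ) : ℝ) := hx
      have : -streamLLR (P₁ k) (P₀ k) (n + 1) x / ((n + 1 : ℕ) : ℝ) ≤ J k - ε * J k := by
        rw [div_le_iff₀ (by positivity)]
        linarith
      exact this
  have hfin : ∑' n, μ {ω | bad ω n} < ⊤ := by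
    -- The summability hypothesis starts at n = 1; the term n = 0 is finite on its own.
    rw [tsum_eq_zero_add' ENNReal.summable]
    refine ENNReal.add_lt_top.2 ⟨measure_lt_top _ _, ?_⟩
    calc _ ≤ ∑' n, ∑ k, μ {ω : Obs E | ω k ∈ S (n + 1) k} :=
          ENNReal.tsum_le_tsum fun n => by
            rw [hbadset]; exact measure_iUnion_fintype_le _ _
      _ = ∑ k, ∑' n, μ {ω : Obs E | ω k ∈ S (n + 1) k} :=
          Summable.tsum_finsetSum fun _ _ => ENNReal.summable
      _ < ⊤ := ENNReal.sum_lt_top.2 fun k _ => hstream k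
  -- The bad events do not involve the thresholds, so this constant is uniform in them. The 2 covers
  -- the ceiling in `N` and the extra 1 that ensures n ≥ 1.
  refine ⟨2 + (∑' n, μ {ω | bad ω n}).toReal, by positivity, fun a b c d k => ?_⟩
  set X : ℝ := max (max ((if A.card = l then c else a) * signalWeight I J l A)
    ((if A.card = u then d else b) * noiseWeight I J u A)) 0 with hX
  have hX0 : 0 ≤ X := le_max_right _ _
  have hε' : 0 < 1 - ε := by linarith
  set N : ℕ := ⌈X / (1 - ε)⌉₊ + 1 with hN
  have hpoint : ∀ ω, ((syncTest P₀ P₁ l u a b c d).T k ω : ℝ≥0∞) ≤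
      N + ∑' n, if bad ω n then 1 else 0 := by
    intro ω
    refine time_le_add_tsum_indicator fun n hn hgood => ?_
    have hgood' : ∀ k, ω k ∉ S n k := fun k hk => hgood ⟨k, hk⟩
    have hXn : X ≤ (1 - ε) * n := by
      have h1 : X / (1 - ε) ≤ n := (Nat.le_ceil _).trans (by exact_mod_cast (by omega))
      rw [div_le_iff₀ hε'] at h1
      linarith
    refine syncTime_le_of_growth hI hJ hu hl hlA hAu hε (by omega) (fun i hi => ?_)
      (fun j hj => ?_) ?_ ?_
    · have := hgood' i
      simp only [hS, if_pos hi] at this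
      exact (not_le.1 this).le
    · have := hgood' j
      simp only [hS, if_neg hj] at this
      exact (not_le.1 this).le
    · exact ((le_max_left _ _).trans (le_max_left _ _)).trans hXn
    · exact ((le_max_right _ _).trans (le_max_left _ _)).trans hXn
  calc (syncTest P₀ P₁ l u a b c d).expectedTime P₀ P₁ A k
      ≤ ∫⁻ ω, (N + ∑' n, {ω | bad ω n}.indicator 1 ω) ∂μ := by
        refine lintegral_mono fun ω => (hpoint ω).trans_eq ?_
        simp only [Set.indicator_apply, Pi.one_apply]
        rfl
    _ = N + ∑' n, μ {ω | bad ω n} := by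
        rw [lintegral_add_left measurable_const, lintegral_const, measure_univ, mul_one,
          lintegral_tsum fun n => (measurable_one.indicator (hbadmeas n)).aemeasurable]
        simp_rw [lintegral_indicator_one (hbadmeas _)]
    _ ≤ _ := by
        have hNle : (N : ℝ) ≤ X / (1 - ε) + 2 := by
          have := (Nat.ceil_lt_add_one (div_nonneg hX0 hε'.le)).le
          rw [hN]; push_cast; linarith
        rw [← ENNReal.ofReal_toReal hfin.ne, ← ENNReal.ofReal_natCast,
          ← ENNReal.ofReal_add (by positivity) ENNReal.toReal_nonneg,
          ENNReal.toReal_ofReal ENNReal.toReal_nonneg]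
        exact ENNReal.ofReal_le_ofReal (by linarith)

end Joint

/-! ### Lower bounds for all synchronous tests -/

section LowerBound

variable {K : ℕ} {E : Fin K → Type*} [∀ k, MeasurableSpace (E k)]
  (P₀ P₁ : ∀ k, Measure (ℕ → E k))

theorem DecisionRule.IsSequentialTest.measurableSet_time_le {χ : DecisionRule E}
    (hχ : χ.IsSequentialTest) (k : Fin K) (m : ℕ) : MeasurableSet {ω | χ.T k ω ≤ m} :=
  (obsFiltration E).le m _ ((hχ k).1 m)

theorem DecisionRule.IsSynchronous.expectedTime_eq {χ : DecisionRule E} (hχ : χ.IsSynchronous)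
    (A : Finset (Fin K)) (j k : Fin K) :
    χ.expectedTime P₀ P₁ A j = χ.expectedTime P₀ P₁ A k := by
  rw [DecisionRule.expectedTime, DecisionRule.expectedTime, hχ j k]

variable [∀ k, IsProbabilityMeasure (P₀ k)] [∀ k, IsProbabilityMeasure (P₁ k)]

/-- Lower bound from a signal of `A` that is a noise under an alternative `A'` in the class. -/
theorem eventually_le_expectedTime_of_signal (hequiv : ∀ k, LocallyEquivalent (P₁ k) (P₀ k))
    {I J : Fin K → ℝ}
    (hsup₁ : ∀ k, LimsupRateLE (P₁ k) (fun n => streamLLR (P₁ k) (P₀ k) n) (I k))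
    (hsup₀ : ∀ k, LimsupRateLE (P₀ k) (fun n x => -streamLLR (P₁ k) (P₀ k) n x) (J k))
    {C : Set (Finset (Fin K))} {A A' : Finset (Fin K)} (hA : A ∈ C) (hA' : A' ∈ C) {i : Fin K}
    (hi : i ∈ A) (hi' : i ∉ A') (hR : 0 < divergenceRate I J A A') {δ : ℝ} (hδ : 0 < δ)
    (hδ1 : δ < 1) (k : Fin K) :
    ∀ᶠ p : ℝ × ℝ in 𝓝[>] 0 ×ˢ 𝓝[>] 0,
      ∀ χ ∈ {χ : DecisionRule E | χ.IsSynchronous} ∩ ControlledTests P₀ P₁ p.1 p.2 C,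
        ENNReal.ofReal ((1 - δ) * (|Real.log p.1| * (divergenceRate I J A A')⁻¹)) ≤
          χ.expectedTime P₀ P₁ A k := by
  filter_upwards [eventually_le_lintegral_time P₀ P₁ hequiv A A' hR
    (fun ε hε => ae_eventually_setLLR_le P₀ P₁ hsup₁ hsup₀ A A' hε) Prod.fst Prod.snd
    tendsto_fst tendsto_snd hδ hδ1] with p hp
  rintro χ ⟨hsync, hseq, hctl⟩
  rw [hsync.expectedTime_eq P₀ P₁ A k i]
  -- Failure of this event under A is a missed signal, controlled by β; its occurrence under A' is a
  -- false alarm, controlled by α.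
  refine hp (χ.T i) {ω | i ∈ χ.D ω} (hseq i).2.1 (hseq.measurableSet_time_le i)
    (fun m hm => ((hseq i).2.2 m hm).1) ?_ ?_
  · refine le_trans (measure_mono ?_) (hctl A hA).2.2
    exact fun ω hω => ⟨i, hi, hω⟩
  · refine le_trans (measure_mono ?_) (hctl A' hA').2.1
    exact fun ω hω => ⟨i, hi', hω⟩

/-- Lower bound from a noise of `A` that is a signal under an alternative `A'` in the class. -/
theorem eventually_le_expectedTime_of_noise (hequiv : ∀ k, LocallyEquivalent (P₁ k) (P₀ k))
    {I J : Fin K → ℝ}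
    (hsup₁ : ∀ k, LimsupRateLE (P₁ k) (fun n => streamLLR (P₁ k) (P₀ k) n) (I k))
    (hsup₀ : ∀ k, LimsupRateLE (P₀ k) (fun n x => -streamLLR (P₁ k) (P₀ k) n x) (J k))
    {C : Set (Finset (Fin K))} {A A' : Finset (Fin K)} (hA : A ∈ C) (hA' : A' ∈ C) {j : Fin K}
    (hj : j ∉ A) (hj' : j ∈ A') (hR : 0 < divergenceRate I J A A') {δ : ℝ} (hδ : 0 < δ)
    (hδ1 : δ < 1) (k : Fin K) :
    ∀ᶠ p : ℝ × ℝ in 𝓝[>] 0 ×ˢ 𝓝[>] 0,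
      ∀ χ ∈ {χ : DecisionRule E | χ.IsSynchronous} ∩ ControlledTests P₀ P₁ p.1 p.2 C,
        ENNReal.ofReal ((1 - δ) * (|Real.log p.2| * (divergenceRate I J A A')⁻¹)) ≤
          χ.expectedTime P₀ P₁ A k := by
  filter_upwards [eventually_le_lintegral_time P₀ P₁ hequiv A A' hR
    (fun ε hε => ae_eventually_setLLR_le P₀ P₁ hsup₁ hsup₀ A A' hε) Prod.snd Prod.fst
    tendsto_snd tendsto_fst hδ hδ1] with p hp
  rintro χ ⟨hsync, hseq, hctl⟩
  rw [hsync.expectedTime_eq P₀ P₁ A k j]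
  -- The roles are exchanged: failure under A is a false alarm, and occurrence under A' is a missed
  -- signal.
  refine hp (χ.T j) {ω | j ∉ χ.D ω} (hseq j).2.1 (hseq.measurableSet_time_le j)
    (fun m hm => ((hseq j).2.2 m hm).2) ?_ ?_
  · refine le_trans (measure_mono ?_) (hctl A hA).2.1
    exact fun ω hω => ⟨j, hj, not_not.1 hω⟩
  · refine le_trans (measure_mono ?_) (hctl A' hA').2.2
    exact fun ω hω => ⟨j, hj', hω⟩

variable {I J : Fin K → ℝ} {A : Finset (Fin K)}

theorem divergenceRate_erase {i : Fin K} (hi : i ∈ A) :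
    divergenceRate I J A (A.erase i) = I i := by
  have h1 : A \ A.erase i = {i} := by
    ext k; simp only [Finset.mem_sdiff, Finset.mem_erase, Finset.mem_singleton]; grind
  have h2 : A.erase i \ A = ∅ := Finset.sdiff_eq_empty_iff_subset.2 (Finset.erase_subset _ _)
  simp [divergenceRate, h1, h2]

theorem divergenceRate_insert {j : Fin K} (hj : j ∉ A) :
    divergenceRate I J A (insert j A) = J j := by
  have h1 : insert j A \ A = {j} := by
    ext k; simp only [Finset.mem_sdiff, Finset.mem_insert, Finset.mem_singleton]; grind
  have h2 : A \ insert j A = ∅ := Finset.sdiff_eq_empty_iff_subset.2 (Finset.subset_insert _ _)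
  simp [divergenceRate, h1, h2]

theorem divergenceRate_swap {i j : Fin K} (hi : i ∈ A) (hj : j ∉ A) :
    divergenceRate I J A (insert j (A.erase i)) = I i + J j := by
  have hij : i ≠ j := fun h => hj (h ▸ hi)
  have h1 : A \ insert j (A.erase i) = {i} := by
    ext k
    simp only [Finset.mem_sdiff, Finset.mem_insert, Finset.mem_erase, Finset.mem_singleton]
    grind
  have h2 : insert j (A.erase i) \ A = {j} := by
    ext k
    simp only [Finset.mem_sdiff, Finset.mem_insert, Finset.mem_erase, Finset.mem_singleton]
    grind
  simp [divergenceRate, h1, h2]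

theorem card_swap {i j : Fin K} (hi : i ∈ A) (hj : j ∉ A) :
    (insert j (A.erase i)).card = A.card := by
  rw [Finset.card_insert_of_notMem fun h => hj (Finset.mem_of_mem_erase h),
    Finset.card_erase_add_one hi]

/-- If |A| > l the alternative drops the weakest signal. If |A| = l it must keep its size, so that
signal is exchanged for the weakest noise, which adds J to the rate. -/
theorem eventually_signal_le_expectedTime (hequiv : ∀ k, LocallyEquivalent (P₁ k) (P₀ k))
    (hI : ∀ k, 0 < I k) (hJ : ∀ k, 0 < J k)
    (hsup₁ : ∀ k, LimsupRateLE (P₁ k) (fun n => streamLLR (P₁ k) (P₀ k) n) (I k))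
    (hsup₀ : ∀ k, LimsupRateLE (P₀ k) (fun n x => -streamLLR (P₁ k) (P₀ k) n x) (J k))
    {l u : ℕ} (hl : l < K) (hA : A ∈ signalClass K l u) {δ : ℝ} (hδ : 0 < δ) (hδ1 : δ < 1)
    (k : Fin K) :
    ∀ᶠ p : ℝ × ℝ in 𝓝[>] 0 ×ˢ 𝓝[>] 0,
      ∀ χ ∈ {χ : DecisionRule E | χ.IsSynchronous} ∩
          ControlledTests P₀ P₁ p.1 p.2 (signalClass K l u),
        ENNReal.ofReal ((1 - δ) * (|Real.log p.1| * signalWeight I J l A)) ≤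
          χ.expectedTime P₀ P₁ A k := by
  rcases A.eq_empty_or_nonempty with rfl | hne
  · simp [signalWeight_empty]
  obtain ⟨i, hi, -, h⟩ := exists_signalWeight_eq hI hJ hl hne
  by_cases hcard : A.card = l
  · rw [if_pos hcard] at h
    obtain ⟨j, hj, -, hw⟩ := h
    have hj := Finset.mem_compl.1 hj
    rw [hw, ← divergenceRate_swap (I := I) (J := J) hi hj]
    refine eventually_le_expectedTime_of_signal P₀ P₁ hequiv hsup₁ hsup₀ hA
      ⟨?_, ?_⟩ hi ?_ ?_ hδ hδ1 k
    · rw [card_swap hi hj]; exact hA.1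
    · rw [card_swap hi hj]; exact hA.2
    · simpa using fun h : i = j => hj (h ▸ hi)
    · rw [divergenceRate_swap hi hj]; exact add_pos (hI i) (hJ j)
  · rw [if_neg hcard] at h
    rw [h, ← divergenceRate_erase (I := I) (J := J) hi]
    have hlt := lt_of_le_of_ne hA.1 (Ne.symm hcard)
    refine eventually_le_expectedTime_of_signal P₀ P₁ hequiv hsup₁ hsup₀ hA
      ⟨?_, ?_⟩ hi (Finset.notMem_erase _ _) ?_ hδ hδ1 k
    · rw [Finset.card_erase_of_mem hi]; exact Nat.le_sub_one_of_lt hlt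
    · exact (Finset.card_erase_le).trans hA.2
    · rw [divergenceRate_erase hi]; exact hI i

/-- Dually, the weakest noise is added when |A| < u and exchanged for the weakest signal when |A| =
u. -/
theorem eventually_noise_le_expectedTime (hequiv : ∀ k, LocallyEquivalent (P₁ k) (P₀ k))
    (hI : ∀ k, 0 < I k) (hJ : ∀ k, 0 < J k)
    (hsup₁ : ∀ k, LimsupRateLE (P₁ k) (fun n => streamLLR (P₁ k) (P₀ k) n) (I k))
    (hsup₀ : ∀ k, LimsupRateLE (P₀ k) (fun n x => -streamLLR (P₁ k) (P₀ k) n x) (J k))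
    {l u : ℕ} (hu : 0 < u) (hA : A ∈ signalClass K l u) {δ : ℝ} (hδ : 0 < δ) (hδ1 : δ < 1)
    (k : Fin K) :
    ∀ᶠ p : ℝ × ℝ in 𝓝[>] 0 ×ˢ 𝓝[>] 0,
      ∀ χ ∈ {χ : DecisionRule E | χ.IsSynchronous} ∩
          ControlledTests P₀ P₁ p.1 p.2 (signalClass K l u),
        ENNReal.ofReal ((1 - δ) * (|Real.log p.2| * noiseWeight I J u A)) ≤
          χ.expectedTime P₀ P₁ A k := by
  rcases (Aᶜ).eq_empty_or_nonempty with hc | hne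
  · simp [noiseWeight_of_compl_eq_empty hc]
  obtain ⟨j, hj, -, h⟩ := exists_noiseWeight_eq hI hJ hu hne
  have hj := Finset.mem_compl.1 hj
  by_cases hcard : A.card = u
  · rw [if_pos hcard] at h
    obtain ⟨i, hi, -, hw⟩ := h
    rw [hw, add_comm, ← divergenceRate_swap (I := I) (J := J) hi hj]
    refine eventually_le_expectedTime_of_noise P₀ P₁ hequiv hsup₁ hsup₀ hA
      ⟨?_, ?_⟩ hj (Finset.mem_insert_self _ _) ?_ hδ hδ1 k
    · rw [card_swap hi hj]; exact hA.1
    · rw [card_swap hi hj]; exact hA.2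
    · rw [divergenceRate_swap hi hj]; exact add_pos (hI i) (hJ j)
  · rw [if_neg hcard] at h
    rw [h, ← divergenceRate_insert (I := I) (J := J) hj]
    have hlt := lt_of_le_of_ne hA.2 hcard
    refine eventually_le_expectedTime_of_noise P₀ P₁ hequiv hsup₁ hsup₀ hA
      ⟨?_, ?_⟩ hj (Finset.mem_insert_self _ _) ?_ hδ hδ1 k
    · exact hA.1.trans (Finset.card_le_card (Finset.subset_insert _ _))
    · rw [Finset.card_insert_of_notMem hj]; exact hlt
    · rw [divergenceRate_insert hj]; exact hJ j

end LowerBound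

/-! ### From two-sided bounds to asymptotic equivalence -/

section Asymptotics

variable {ι : Type*} {L : Filter ι}

theorem tendsto_toReal_div {f : ι → ℝ≥0∞} {s : ι → ℝ} (hs : ∀ᶠ p in L, 0 < s p)
    (hf : ∀ δ : ℝ, 0 < δ → δ < 1 → ∀ᶠ p in L,
      ENNReal.ofReal ((1 - δ) * s p) ≤ f p ∧ f p ≤ ENNReal.ofReal ((1 + δ) * s p)) :
    Tendsto (fun p => (f p).toReal / s p) L (𝓝 1) := by
  refine Metric.tendsto_nhds.2 fun ε hε => ?_
  set δ := min (ε / 2) (1 / 2) with hδ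
  have hδ0 : 0 < δ := by positivity
  have hδε : δ < ε := (min_le_left _ _).trans_lt (by linarith)
  have hδ1 : δ < 1 := (min_le_right _ _).trans_lt (by norm_num)
  filter_upwards [hs, hf δ hδ0 hδ1] with p hsp ⟨h1, h2⟩
  have hne : f p ≠ ⊤ := ne_top_of_le_ne_top ENNReal.ofReal_ne_top h2
  have h1' := (ENNReal.ofReal_le_iff_le_toReal hne).1 h1
  have h2' := ENNReal.toReal_le_of_le_ofReal
    (mul_nonneg (by linarith : (0 : ℝ) ≤ 1 + δ) hsp.le) h2
  rw [Real.dist_eq, abs_lt]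
  rw [← le_div_iff₀ hsp] at h1'
  rw [← div_le_iff₀ hsp] at h2'
  exact ⟨by linarith, by linarith⟩

/-- Both functions are compared with the real scale `s`, which cancels. The bounds make f and g
finite and g nonzero, so the real quotient agrees with the extended one. -/
theorem tendsto_div_of_bounds {f g : ι → ℝ≥0∞} {s : ι → ℝ} (hs : ∀ᶠ p in L, 0 < s p)
    (hf : ∀ δ : ℝ, 0 < δ → δ < 1 → ∀ᶠ p in L,
      ENNReal.ofReal ((1 - δ) * s p) ≤ f p ∧ f p ≤ ENNReal.ofReal ((1 + δ) * s p))
    (hg : ∀ δ : ℝ, 0 < δ → δ < 1 → ∀ᶠ p in L,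
      ENNReal.ofReal ((1 - δ) * s p) ≤ g p ∧ g p ≤ ENNReal.ofReal ((1 + δ) * s p)) :
    Tendsto (fun p => f p / g p) L (𝓝 1) := by
  have h := ENNReal.tendsto_ofReal
    ((tendsto_toReal_div hs hf).div (tendsto_toReal_div hs hg) one_ne_zero)
  rw [div_one, ENNReal.ofReal_one] at h
  refine h.congr' ?_
  filter_upwards [hs, hf (1 / 2) (by norm_num) (by norm_num),
    hg (1 / 2) (by norm_num) (by norm_num)] with p hsp ⟨_, hf2⟩ ⟨hg1, hg2⟩
  have hfne : f p ≠ ⊤ := ne_top_of_le_ne_top ENNReal.ofReal_ne_top hf2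
  have hgne : g p ≠ ⊤ := ne_top_of_le_ne_top ENNReal.ofReal_ne_top hg2
  have hg0 : 0 < g p := (ENNReal.ofReal_pos.2 (mul_pos (by norm_num) hsp)).trans_le hg1
  have hgR : 0 < (g p).toReal := ENNReal.toReal_pos hg0.ne' hgne
  rw [Pi.div_apply, div_div_div_cancel_right₀ hsp.ne', ENNReal.ofReal_div_of_pos hgR,
    ENNReal.ofReal_toReal hfne, ENNReal.ofReal_toReal hgne]

/-- Only this half of the equivalence matters: large thresholds delay the rule, while the lower
bound holds for every controlled test. -/
theorem ThresholdEquiv.eventually_le {h : ℝ → ℝ → ℝ} {γ : ℝ × ℝ → ℝ} (hh : ThresholdEquiv h γ)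
    (hγ : Tendsto γ (𝓝[>] 0 ×ˢ 𝓝[>] 0) (𝓝[>] 0)) {ε : ℝ} (hε : 0 < ε) :
    ∀ᶠ p in 𝓝[>] 0 ×ˢ 𝓝[>] 0, h p.1 p.2 ≤ (1 + ε) * |Real.log (γ p)| := by
  have hlog : Tendsto (fun p => |Real.log (γ p)|) (𝓝[>] 0 ×ˢ 𝓝[>] 0) atTop :=
    (tendsto_abs_atBot_atTop.comp Real.tendsto_log_nhdsGT_zero).comp hγ
  filter_upwards [hh.eventually_lt_const (by linarith : (1 : ℝ) < 1 + ε),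
    hlog.eventually_gt_atTop 0] with p hp hp0
  exact ((div_lt_iff₀ hp0).1 hp).le

end Asymptotics

end SeqMT

/-! ### The squeeze -/

theorem theorem4p3 {K : ℕ} {E : Fin K → Type*} [∀ k, MeasurableSpace (E k)]
    (P₀ P₁ : ∀ k, Measure (ℕ → E k))
    [∀ k, IsProbabilityMeasure (P₀ k)] [∀ k, IsProbabilityMeasure (P₁ k)]
    (hequiv : ∀ k, LocallyEquivalent (P₁ k) (P₀ k))
    (I J : Fin K → ℝ) (hI : ∀ k, 0 < I k) (hJ : ∀ k, 0 < J k)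
    (hsup₁ : ∀ k, LimsupRateLE (P₁ k) (fun n => streamLLR (P₁ k) (P₀ k) n) (I k))
    (hsup₀ : ∀ k, LimsupRateLE (P₀ k) (fun n x => -streamLLR (P₁ k) (P₀ k) n x) (J k))
    (hcc₁ : ∀ k, CompleteLowerRate (P₁ k) (fun n => streamLLR (P₁ k) (P₀ k) n) (I k))
    (hcc₀ : ∀ k, CompleteLowerRate (P₀ k) (fun n x => -streamLLR (P₁ k) (P₀ k) n x) (J k))
    (l u : ℕ) (hlu : l ≤ u) (huK : u ≤ K) (hu : 0 < u) (hl : l < K)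
    (a b c d : ℝ → ℝ → ℝ)
    (hpos : ∀ α ∈ Set.Ioo (0 : ℝ) 1, ∀ β ∈ Set.Ioo (0 : ℝ) 1,
      0 < a α β ∧ 0 < b α β ∧ 0 < c α β ∧ 0 < d α β)
    (hcontrol : ∀ α ∈ Set.Ioo (0 : ℝ) 1, ∀ β ∈ Set.Ioo (0 : ℝ) 1,
      syncTest P₀ P₁ l u (a α β) (b α β) (c α β) (d α β) ∈
        ControlledTests P₀ P₁ α β (signalClass K l u))
    (ha : ThresholdEquiv a Prod.fst) (hc : ThresholdEquiv c Prod.fst)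
    (hb : ThresholdEquiv b Prod.snd) (hd : ThresholdEquiv d Prod.snd) :
    ∀ A ∈ signalClass K l u,
      AsympEquiv
        (fun α β => (syncTest P₀ P₁ l u (a α β) (b α β) (c α β) (d α β)).expectedTime
          P₀ P₁ A ⟨0, Nat.zero_lt_of_lt hl⟩)
        (fun α β => optimalSyncTime P₀ P₁ α β (signalClass K l u) A ⟨0, Nat.zero_lt_of_lt hl⟩) ∧
      AsympEquiv
        (fun α β => optimalSyncTime P₀ P₁ α β (signalClass K l u) A ⟨0, Nat.zero_lt_of_lt hl⟩)
        (fun α β => syncRate I J l u A α β) := by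
  intro A hA
  set k₀ : Fin K := ⟨0, Nat.zero_lt_of_lt hl⟩ with hk₀
  set L : Filter (ℝ × ℝ) := 𝓝[>] 0 ×ˢ 𝓝[>] 0 with hL
  set wα := signalWeight I J l A with hwα
  set wβ := noiseWeight I J u A with hwβ
  have hwα0 : 0 ≤ wα := signalWeight_nonneg
  have hwβ0 : 0 ≤ wβ := noiseWeight_nonneg
  set s : ℝ × ℝ → ℝ := fun p => max (|Real.log p.1| * wα) (|Real.log p.2| * wβ) with hs
  set f : ℝ × ℝ → ℝ≥0∞ := fun p => (syncTest P₀ P₁ l u (a p.1 p.2) (b p.1 p.2) (c p.1 p.2)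
    (d p.1 p.2)).expectedTime P₀ P₁ A k₀ with hf
  set g : ℝ × ℝ → ℝ≥0∞ := fun p =>
    optimalSyncTime P₀ P₁ p.1 p.2 (signalClass K l u) A k₀ with hg
  have hlog : Tendsto (fun t : ℝ => |Real.log t|) (𝓝[>] 0) atTop :=
    tendsto_abs_atBot_atTop.comp Real.tendsto_log_nhdsGT_zero
  -- There is at least one stream, so A or its complement is nonempty and the corresponding weight
  -- is positive.
  have hlim : Tendsto s L atTop := by
    rcases A.eq_empty_or_nonempty with hne | hne
    · have hc : Aᶜ.Nonempty := by
        rw [hne, Finset.compl_empty]; exact ⟨k₀, Finset.mem_univ _⟩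
      exact tendsto_atTop_mono (fun p => le_max_right _ _)
        ((hlog.comp tendsto_snd).atTop_mul_const (noiseWeight_pos hI hJ hu hc))
    · exact tendsto_atTop_mono (fun p => le_max_left _ _)
        ((hlog.comp tendsto_fst).atTop_mul_const (signalWeight_pos hI hJ hl hne))
  have hgf : ∀ᶠ p in L, g p ≤ f p := by
    have h1 : ∀ᶠ p : ℝ × ℝ in L, p.1 ∈ Set.Ioo (0 : ℝ) 1 :=
      tendsto_fst.eventually (Ioo_mem_nhdsGT one_pos)
    have h2 : ∀ᶠ p : ℝ × ℝ in L, p.2 ∈ Set.Ioo (0 : ℝ) 1 :=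
      tendsto_snd.eventually (Ioo_mem_nhdsGT one_pos)
    filter_upwards [h1, h2] with p hp1 hp2
    exact iInf₂_le _ ⟨fun _ _ => rfl, hcontrol _ hp1 _ hp2⟩
  have hlower : ∀ δ : ℝ, 0 < δ → δ < 1 → ∀ᶠ p in L, ENNReal.ofReal ((1 - δ) * s p) ≤ g p := by
    intro δ hδ hδ1
    filter_upwards [eventually_signal_le_expectedTime P₀ P₁ hequiv hI hJ hsup₁ hsup₀ hl hA hδ
      hδ1 k₀, eventually_noise_le_expectedTime P₀ P₁ hequiv hI hJ hsup₁ hsup₀ hu hA hδ hδ1 k₀]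
      with p h1 h2
    refine le_iInf₂ fun χ hχ => ?_
    rw [hs, mul_max_of_nonneg _ _ (by linarith), ENNReal.ofReal_max]
    exact max_le (h1 χ hχ) (h2 χ hχ)
  have hupper : ∀ δ : ℝ, 0 < δ → δ < 1 → ∀ᶠ p in L, f p ≤ ENNReal.ofReal ((1 + δ) * s p) := by
    intro δ hδ hδ1
    -- For ε ≤ 1/3, (1 + ε) / (1 - ε) ≤ 1 + 3ε. One more ε absorbs the constant `B`, since `s` tends
    -- to infinity; in total 1 + 4ε = 1 + δ.
    set ε := δ / 4 with hε
    have hε0 : 0 < ε := by positivity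
    have hε1 : ε < 1 / 4 := by linarith
    obtain ⟨B, -, hB⟩ := exists_expectedTime_le P₀ P₁ hI hJ hcc₁ hcc₀ hu hl hA.1 hA.2 hε0
      (by linarith)
    have hfst : Tendsto Prod.fst L (𝓝[>] (0 : ℝ)) := tendsto_fst
    have hsnd : Tendsto Prod.snd L (𝓝[>] (0 : ℝ)) := tendsto_snd
    filter_upwards [ha.eventually_le hfst hε0, hb.eventually_le hsnd hε0,
      hc.eventually_le hfst hε0, hd.eventually_le hsnd hε0,
      hlim.eventually_ge_atTop (B / ε)] with p hpa hpb hpc hpd hpB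
    refine (hB _ _ _ _ k₀).trans (ENNReal.ofReal_le_ofReal ?_)
    have hs0 : 0 ≤ s p := (mul_nonneg (abs_nonneg _) hwα0).trans (le_max_left _ _)
    have hα : (if A.card = l then c p.1 p.2 else a p.1 p.2) ≤ (1 + ε) * |Real.log p.1| := by
      split_ifs <;> assumption
    have hβ : (if A.card = u then d p.1 p.2 else b p.1 p.2) ≤ (1 + ε) * |Real.log p.2| := by
      split_ifs <;> assumption
    have hX : max (max ((if A.card = l then c p.1 p.2 else a p.1 p.2) * wα)
        ((if A.card = u then d p.1 p.2 else b p.1 p.2) * wβ)) 0 ≤ (1 + ε) * s p := by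
      refine max_le (max_le ?_ ?_) (by positivity)
      · refine (mul_le_mul_of_nonneg_right hα hwα0).trans ?_
        rw [mul_assoc]
        exact mul_le_mul_of_nonneg_left (le_max_left _ _) (by linarith)
      · refine (mul_le_mul_of_nonneg_right hβ hwβ0).trans ?_
        rw [mul_assoc]
        exact mul_le_mul_of_nonneg_left (le_max_right _ _) (by linarith)
    have hX' : max (max ((if A.card = l then c p.1 p.2 else a p.1 p.2) * wα)
        ((if A.card = u then d p.1 p.2 else b p.1 p.2) * wβ)) 0 / (1 - ε) ≤
        (1 + 3 * ε) * s p := by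
      rw [div_le_iff₀ (by linarith)]
      refine hX.trans ?_
      have : (1 + ε) ≤ (1 + 3 * ε) * (1 - ε) := by nlinarith
      calc (1 + ε) * s p ≤ ((1 + 3 * ε) * (1 - ε)) * s p := by gcongr
        _ = _ := by ring
    have hB' : B ≤ ε * s p := by
      rw [div_le_iff₀ hε0] at hpB
      linarith
    calc _ ≤ (1 + 3 * ε) * s p + ε * s p := add_le_add hX' hB'
      _ = (1 + δ) * s p := by rw [hε]; ring
  have hs0 : ∀ᶠ p in L, 0 < s p := hlim.eventually_gt_atTop 0
  have hfb : ∀ δ : ℝ, 0 < δ → δ < 1 → ∀ᶠ p in L,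
      ENNReal.ofReal ((1 - δ) * s p) ≤ f p ∧ f p ≤ ENNReal.ofReal ((1 + δ) * s p) := by
    intro δ hδ hδ1
    filter_upwards [hlower δ hδ hδ1, hupper δ hδ hδ1, hgf] with p h1 h2 h3
    exact ⟨h1.trans h3, h2⟩
  have hgb : ∀ δ : ℝ, 0 < δ → δ < 1 → ∀ᶠ p in L,
      ENNReal.ofReal ((1 - δ) * s p) ≤ g p ∧ g p ≤ ENNReal.ofReal ((1 + δ) * s p) := by
    intro δ hδ hδ1
    filter_upwards [hlower δ hδ hδ1, hupper δ hδ hδ1, hgf] with p h1 h2 h3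
    exact ⟨h1, h3.trans h2⟩
  refine ⟨tendsto_div_of_bounds hs0 hfb hgb, ?_⟩
  refine tendsto_div_of_bounds hs0 hgb fun δ hδ hδ1 => ?_
  filter_upwards [hs0] with p hp
  rw [syncRate_eq hI hJ]
  exact ⟨ENNReal.ofReal_le_ofReal (by nlinarith), ENNReal.ofReal_le_ofReal (by nlinarith)⟩
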